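/- Let $\gamma>2$. For $m\in L^1(\mathbb R)$ (complex valued) put $\widehat m(k)=\int_{\mathbb R}m(x)e^{-ikx}\,dx$, extended to tempered distributions in the usual way; for $\beta\in\mathbb R$ let $L^2_\beta=L^2(\mathbb R;e^{-\beta k}dk)$, $\|f\|_{L^2_\beta}^2=\int_{\mathbb R}|f(k)|^2e^{-\beta k}\,dk$; and let $\exp$ denote the function $k\mapsto e^k$. Define $$M_\gamma=\inf_{m}\ \|m\|_{L^1}^{\gamma-2}\,\|\widehat m-\exp\|_{L^2_\gamma}^2 ,$$ where the infimum is over all $m\in L^1(\mathbb R)$ with $\widehat m-\exp\in L^2_\gamma$ (for other $m\in L^1(\mathbb R)$ the functional is $+\infty$). 1. The infimum is attained. The minimizer is unique up to the transformations $m(x)\mapsto m(x)\,\alpha^{-ix-1}$, $\alpha>0$: if $m$ is a minimizer, then the minimizers are exactly the functions $x\mapsto m(x)\,\alpha^{-ix-1}$ with $\alpha>0$ (as elements of $L^1(\mathbb R)$). 2. For every $g\in C_0(\mathbb R)$ (continuous, complex valued, vanishing at infinity) whose distributional Fourier transform $\widehat g$ is a function in $L^2_{-\gamma}$, the limit $$\langle\exp,\widehat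 g\rangle:=\lim_{\varepsilon\downarrow0}\int_{\mathbb R}\varphi(\varepsilon k)\,\widehat g(k)\,e^k\,dk,\qquad \varphi\in C_c^\infty(\mathbb R),\ \varphi(0)=1,$$ exists in $\mathbb C$ and does not depend on $\varphi$, and $$M_\gamma=\frac{4(\gamma-2)^{\gamma-2}}{(2\pi)^{\gamma-2}\gamma^\gamma}\ \sup_{\substack{0\neq g\in C_0(\mathbb R)\\ \widehat g\in L^2_{-\gamma}}}\ \frac{|\langle\exp,\widehat g\rangle|^{\gamma}}{\|g\|_{L^\infty}^{\gamma-2}\,\|\widehat g\|_{L^2_{-\gamma}}^2},$$ where the supremum is finite. -/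

import Mathlib

open MeasureTheory Filter Topology
open scoped ENNReal ContDiff ZeroAtInfty

namespace PrimalOptimizer

noncomputable section

/-- The measure `e^{-γ k} dk` on `ℝ`. -/
def expWeight (γ : ℝ) : Measure ℝ :=
  (volume : Measure ℝ).withDensity fun k => ENNReal.ofReal (Real.exp (-γ * k))

/-- Membership in the exponentially weighted space `L²_γ(ℝ) = L²(ℝ; e^{-γ k} dk)`. -/
def MemL2 (γ : ℝ) (f : ℝ → ℂ) : Prop :=
  MemLp f 2 (expWeight γ)

/-- The norm of `L²_γ(ℝ)` (meaningful for `f` with `MemL2 γ f`). -/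
def normL2 (γ : ℝ) (f : ℝ → ℂ) : ℝ :=
  (eLpNorm f 2 (expWeight γ)).toReal

/-- The Fourier transform `k ↦ ∫ f(x) e^{-ikx} dx`. -/
def fourier (f : ℝ → ℂ) (k : ℝ) : ℂ :=
  ∫ x : ℝ, f x * Complex.exp (-(Complex.I * (k : ℂ) * (x : ℂ)))

/-- The real exponential function, as a complex valued function. -/
def expFun (k : ℝ) : ℂ := (Real.exp k : ℂ)

/-- The complex Lebesgue space `L¹(ℝ)`. -/
abbrev L1 : Type := Lp ℂ 1 (volume : Measure ℝ)

/-- The effective domain: all `m ∈ L¹(ℝ)` with `m̂ - exp ∈ L²_γ(ℝ)`. -/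
def primalDomain (γ : ℝ) : Set L1 :=
  {m | MemL2 γ fun k => fourier m k - expFun k}

/-- The primal functional `‖m‖₁^{γ-2} ‖m̂ - exp‖²_{L²_γ}`, for `m` in the effective domain. -/
def primalFunctional (γ : ℝ) (m : L1) : ℝ :=
  ‖m‖ ^ (γ - 2) * normL2 γ (fun k => fourier m k - expFun k) ^ 2

/-- The number `M_γ`. Outside the effective domain the functional has the value `+∞`, so the
infimum over `L¹(ℝ)` is the infimum over the effective domain. -/
def primalInf (γ : ℝ) : ℝ :=
  sInf (primalFunctional γ '' primalDomain γ)

/-- `m` is a minimizer of the primal problem. -/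
def IsPrimalMinimizer (γ : ℝ) (m : L1) : Prop :=
  m ∈ primalDomain γ ∧ primalFunctional γ m = primalInf γ

/-- Complex valued test functions, `C_c^∞(ℝ)`. -/
def IsTestFunction (φ : ℝ → ℂ) : Prop :=
  ContDiff ℝ ∞ φ ∧ HasCompactSupport φ

/-- The distributional Fourier transform of the bounded function `g` is the locally integrable
function `u`: `∫ u φ = ∫ g φ̂` for all test functions `φ`. (As `u` may grow exponentially, it is
tested against `C_c^∞(ℝ)`, which is dense in the Schwartz space.) -/
def HasFourierTransform (g u : ℝ → ℂ) : Prop :=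
  LocallyIntegrable u ∧
    ∀ φ : ℝ → ℂ, IsTestFunction φ → ∫ k : ℝ, u k * φ k = ∫ x : ℝ, g x * fourier φ x

/-- `g ∈ C₀(ℝ)` has a Fourier transform in `L²_{-γ}(ℝ)`, given by the function `u`. -/
def IsDualAdmissible (γ : ℝ) (g : C₀(ℝ, ℂ)) (u : ℝ → ℂ) : Prop :=
  HasFourierTransform g u ∧ MemL2 (-γ) u

/-- `⟨exp, u⟩ = z`, as a regularized integral: `∫ φ(εk) u(k) e^k dk → z` as `ε ↓ 0`, for every
test function `φ` with `φ(0) = 1`. -/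
def HasExpPairing (u : ℝ → ℂ) (z : ℂ) : Prop :=
  ∀ φ : ℝ → ℂ, IsTestFunction φ → φ 0 = 1 →
    Tendsto (fun ε : ℝ => ∫ k : ℝ, φ (ε * k) * u k * expFun k) (𝓝[>] 0) (𝓝 z)

/-- The values `|⟨exp, ĝ⟩|^γ / (‖g‖_∞^{γ-2} ‖ĝ‖²_{L²_{-γ}})` of the dual functional, for nonzero
`g ∈ C₀(ℝ)` with `ĝ ∈ L²_{-γ}(ℝ)`. The norm of `C₀(ℝ, ℂ)` is the supremum norm. -/
def dualValues (γ : ℝ) : Set ℝ :=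
  {r | ∃ (g : C₀(ℝ, ℂ)) (u : ℝ → ℂ) (z : ℂ), g ≠ 0 ∧ IsDualAdmissible γ g u ∧
    HasExpPairing u z ∧ r = ‖z‖ ^ γ / (‖g‖ ^ (γ - 2) * normL2 (-γ) u ^ 2)}

end

end PrimalOptimizer

open PrimalOptimizer

/-!
For admissible `m` and `(g, u)`, `u = ĝ`, the pairing `⟨exp, ĝ⟩` equals
`2π ∫ m(y) g(-y) dy - ∫ u (m̂ - exp)`, hence is at most
`2π ‖m‖₁ ‖g‖_∞ + ‖m̂ - exp‖_γ ‖u‖_{-γ}` in absolute value. Optimizing this bound over the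
rescalings `m ↦ m(x) α^{-ix-1}`, which leave the primal functional invariant, gives one half of the
duality formula.

Conversely, finiteness of the dual supremum bounds `φ ↦ ∫ φ(k) e^k dk` on test functions by the
maximum norm of `(g, φ)`, where `ĝ = φ`, in `C₀(ℝ) × L²_{-γ}`. A Hahn–Banach extension of this
functional has a component on `C₀(ℝ)`, i.e. a complex measure `ν`, and one in `L²_γ`, which is
`exp - ν̂` up to signs and constants. As `ν̂` thus decays exponentially on a half-line, a variant of
the theorem of F. and M. Riesz shows that `ν` has a density, and by AM–GM this density attains the
infimum. To see that `ν` vanishes on a compact null set `K`, integrate `exp (-N G)` against it,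
where `G` is the Cauchy integral of a small neighbourhood of `K`. The powers of `G` are Laplace
transforms on a half-line, so their integrals only involve the values of `ν̂` where it decays;
moreover `Re G ≥ 0` everywhere and `Re G ≥ 1` on `K`.

Uniqueness follows from strict convexity of the `L²` norm once a minimizer has been rescaled to the
same `L¹` norm as the other one.
-/

namespace PrimalOptimizer

/-! ### Hahn–Banach extensions and functionals on products -/

section Functionals

variable {𝕜 E F : Type*} [RCLike 𝕜] [NormedAddCommGroup E] [NormedSpace 𝕜 E]
  [NormedAddCommGroup F] [NormedSpace 𝕜 F]

theorem exists_strongDual_apply_eq_of_norm_le {V : Type*} [AddCommGroup V] [Module 𝕜 V]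
    (ι : V →ₗ[𝕜] E) (ℓ : V →ₗ[𝕜] 𝕜) {C : ℝ} (hC : 0 ≤ C) (h : ∀ v, ‖ℓ v‖ ≤ C * ‖ι v‖) :
    ∃ f : StrongDual 𝕜 E, ‖f‖ ≤ C ∧ ∀ v, f (ι v) = ℓ v := by
  obtain ⟨L, hL⟩ : ∃ L : Module.Dual 𝕜 E, ι.dualMap L = ℓ := by
    rw [← LinearMap.mem_range, LinearMap.range_dualMap_eq_dualAnnihilator_ker,
      Submodule.mem_dualAnnihilator]
    intro v hv
    simpa [LinearMap.mem_ker.1 hv] using h v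
  have hLι (v : V) : L (ι v) = ℓ v := LinearMap.congr_fun hL v
  have hLC (y : LinearMap.range ι) : ‖L.domRestrict (LinearMap.range ι) y‖ ≤ C * ‖y‖ := by
    obtain ⟨_, v, rfl⟩ := y
    simpa [hLι] using h v
  obtain ⟨f, hf, hf_norm⟩ := exists_extension_norm_eq (LinearMap.range ι)
    ((L.domRestrict (LinearMap.range ι)).mkContinuous C hLC)
  exact ⟨f, hf_norm.trans_le (LinearMap.mkContinuous_norm_le _ hC _),
    fun v => (hf ⟨ι v, v, rfl⟩).trans (hLι v)⟩

theorem norm_comp_inl_add_norm_comp_inr_le (f : StrongDual 𝕜 (E × F)) :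
    ‖f.comp (ContinuousLinearMap.inl 𝕜 E F)‖ + ‖f.comp (ContinuousLinearMap.inr 𝕜 E F)‖ ≤ ‖f‖ := by
  set f₁ := f.comp (ContinuousLinearMap.inl 𝕜 E F)
  set f₂ := f.comp (ContinuousLinearMap.inr 𝕜 E F)
  have on_unit_ball (x : E) (y : F) (hx : ‖x‖ < 1) (hy : ‖y‖ < 1) : ‖f₁ x‖ + ‖f₂ y‖ ≤ ‖f‖ := by
    obtain ⟨c, hc, hcx⟩ := RCLike.exists_norm_eq_mul_self (f₁ x)
    obtain ⟨d, hd, hdy⟩ := RCLike.exists_norm_eq_mul_self (f₂ y)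
    have hf : f (c • x, d • y) = ((‖f₁ x‖ + ‖f₂ y‖ : ℝ) : 𝕜) := by
      rw [RCLike.ofReal_add, hcx, hdy, ← smul_eq_mul, ← smul_eq_mul, ← map_smul, ← map_smul]
      simp only [f₁, f₂, ContinuousLinearMap.comp_apply, ContinuousLinearMap.inl_apply,
        ContinuousLinearMap.inr_apply, ← map_add, Prod.mk_add_mk, add_zero, zero_add]
    have hball : ‖(c • x, d • y)‖ ≤ 1 := by
      simp [Prod.norm_def, norm_smul, hc, hd, hx.le, hy.le]
    have hle := f.le_of_opNorm_le_of_le le_rfl hball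
    rwa [hf, RCLike.norm_ofReal, abs_of_nonneg (by positivity), mul_one] at hle
  by_contra! hlt
  obtain ⟨x, hx, hfx⟩ := f₁.exists_lt_apply_of_lt_opNorm
    (r := ‖f₁‖ - (‖f₁‖ + ‖f₂‖ - ‖f‖) / 2) (by linarith)
  obtain ⟨y, hy, hfy⟩ := f₂.exists_lt_apply_of_lt_opNorm
    (r := ‖f₂‖ - (‖f₁‖ + ‖f₂‖ - ‖f‖) / 2) (by linarith)
  linarith [on_unit_ball x y hx hy]

end Functionals

/-! ### Functionals on `L¹` of a finite measure -/

section LOneDual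

variable {𝕜 α : Type*} [RCLike 𝕜] [MeasurableSpace α] {ν : Measure α}

theorem norm_apply_toL1_le (f : StrongDual 𝕜 (Lp 𝕜 1 ν)) {y : α → 𝕜} (hy : Integrable y ν) :
    ‖f (hy.toL1 y)‖ ≤ ‖f‖ * ∫ x, ‖y x‖ ∂ν :=
  L1.norm_of_fun_eq_integral_norm hy ▸ f.le_opNorm _

theorem integral_norm_le_of_forall_norm_integral_mul_le {h : α → 𝕜}
    (hh : StronglyMeasurable h) {C : ℝ}
    (hC : ∀ y : α → 𝕜, StronglyMeasurable y → (∀ x, ‖y x‖ ≤ 1) → ‖∫ x, y x * h x ∂ν‖ ≤ C) :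
    ∫ x, ‖h x‖ ∂ν ≤ C := by
  have hphase (x : α) : starRingEnd 𝕜 (h x) / (‖h x‖ : 𝕜) * h x = (‖h x‖ : 𝕜) := by
    rcases eq_or_ne (h x) 0 with h0 | h0
    · simp [h0]
    · have : (‖h x‖ : 𝕜) ≠ 0 := by simpa using h0
      rw [div_mul_eq_mul_div, RCLike.conj_mul, sq]
      field_simp
  have hle := hC (fun x => starRingEnd 𝕜 (h x) / (‖h x‖ : 𝕜))
    ((RCLike.continuous_conj.comp_stronglyMeasurable hh).div
      (RCLike.continuous_ofReal.comp_stronglyMeasurable hh.norm))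
    fun x => by simpa using div_self_le_one _
  simp_rw [hphase, integral_ofReal, RCLike.norm_ofReal] at hle
  exact (le_abs_self _).trans hle

variable [IsFiniteMeasure ν]

theorem integrable_Lp_two (y : Lp 𝕜 2 ν) : Integrable y ν :=
  (Lp.memLp y).integrable one_le_two

/-- The inclusion of `L²` into `L¹` over a finite measure, through which functionals on `L¹` become
accessible to the Riesz representation theorem of Hilbert spaces. -/
noncomputable def lpTwoToLpOne (𝕜 : Type*) [RCLike 𝕜] (ν : Measure α) [IsFiniteMeasure ν] :
    Lp 𝕜 2 ν →L[𝕜] Lp 𝕜 1 ν :=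
  LinearMap.mkContinuous
    { toFun := fun y => (integrable_Lp_two y).toL1 y
      map_add' := fun y z => by
        rw [← Integrable.toL1_add, Integrable.toL1_eq_toL1_iff]
        exact Lp.coeFn_add y z
      map_smul' := fun c y => by
        rw [RingHom.id_apply, ← Integrable.toL1_smul', Integrable.toL1_eq_toL1_iff]
        exact Lp.coeFn_smul c y }
    (ν Set.univ ^ (1 / (1 : ℝ≥0∞).toReal - 1 / (2 : ℝ≥0∞).toReal)).toReal
    fun y => by
      change ‖(integrable_Lp_two y).toL1 y‖ ≤ _
      have h_holder := eLpNorm_le_eLpNorm_mul_rpow_measure_univ one_le_two (Lp.memLp y).1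
      rw [Integrable.toL1, Lp.norm_toLp, Lp.norm_def, mul_comm, ← ENNReal.toReal_mul]
      exact ENNReal.toReal_mono (ENNReal.mul_ne_top (Lp.memLp y).2.ne
        (ENNReal.rpow_ne_top_of_nonneg (by norm_num) (measure_ne_top _ _))) h_holder

theorem lpTwoToLpOne_toLp {y : α → 𝕜} (hy : MemLp y 2 ν) :
    lpTwoToLpOne 𝕜 ν (hy.toLp y) = (hy.integrable one_le_two).toL1 y :=
  (Integrable.toL1_eq_toL1_iff _ _ (integrable_Lp_two _) _).2 hy.coeFn_toLp

theorem exists_density_of_strongDual_Lp_one (f : StrongDual 𝕜 (Lp 𝕜 1 ν)) :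
    ∃ h : α → 𝕜, Integrable h ν ∧ ∫ x, ‖h x‖ ∂ν ≤ ‖f‖ * ν.real Set.univ ∧
      ∀ (y : α → 𝕜) (hy : MemLp y 2 ν),
        f ((hy.integrable one_le_two).toL1 y) = ∫ x, y x * h x ∂ν := by
  set v : Lp 𝕜 2 ν := (InnerProductSpace.toDual 𝕜 _).symm (f.comp (lpTwoToLpOne 𝕜 ν))
  have hv : StronglyMeasurable fun x => starRingEnd 𝕜 (v x) :=
    RCLike.continuous_conj.comp_stronglyMeasurable (Lp.stronglyMeasurable v)
  have hrepr (y : α → 𝕜) (hy : MemLp y 2 ν) :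
      f ((hy.integrable one_le_two).toL1 y) = ∫ x, y x * starRingEnd 𝕜 (v x) ∂ν := by
    have hriesz : inner 𝕜 v (hy.toLp y) = f (lpTwoToLpOne 𝕜 ν (hy.toLp y)) :=
      InnerProductSpace.toDual_symm_apply
    rw [← lpTwoToLpOne_toLp hy, ← hriesz, L2.inner_def]
    refine integral_congr_ae ?_
    filter_upwards [hy.coeFn_toLp] with x hx
    rw [hx, RCLike.inner_apply]
  refine ⟨_, ((Lp.memLp v).star.integrable one_le_two : Integrable (star ⇑v) ν),
    integral_norm_le_of_forall_norm_integral_mul_le hv fun y hy hy1 => ?_, hrepr⟩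
  have hy2 : MemLp y 2 ν := MemLp.of_bound hy.aestronglyMeasurable 1 (Eventually.of_forall hy1)
  have hyi := hy2.integrable one_le_two
  rw [← hrepr y hy2]
  refine (norm_apply_toL1_le f hyi).trans ?_
  gcongr
  calc ∫ x, ‖y x‖ ∂ν ≤ ∫ _, (1 : ℝ) ∂ν := integral_mono hyi.norm (integrable_const _) hy1
    _ = ν.real Set.univ := by simp

end LOneDual

/-! ### The dual of `C₀(X, 𝕜)` -/

section Riesz

open scoped NNReal CompactlySupported

variable {X 𝕜 : Type*} [TopologicalSpace X] [RCLike 𝕜]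

theorem norm_zeroAtInfty_apply_le (g : C₀(X, 𝕜)) (x : X) : ‖g x‖ ≤ ‖g‖ :=
  g.toBCF.norm_coe_le_norm x

theorem norm_zeroAtInfty_le {g : C₀(X, 𝕜)} {C : ℝ} (hC : 0 ≤ C) (h : ∀ x, ‖g x‖ ≤ C) :
    ‖g‖ ≤ C :=
  (BoundedContinuousFunction.norm_le hC).2 h

theorem memLp_zeroAtInfty [MeasurableSpace X] [OpensMeasurableSpace X] {ν : Measure X}
    [IsFiniteMeasure ν] (g : C₀(X, 𝕜)) {p : ℝ≥0∞} : MemLp g p ν :=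
  MemLp.of_bound (map_continuous g).aestronglyMeasurable ‖g‖
    (Eventually.of_forall (norm_zeroAtInfty_apply_le g))

theorem continuous_mul_of_forall_continuousAt {θ g : X → 𝕜} (hg : Continuous g)
    (hθ : ∀ x, ‖θ x‖ ≤ 1) (hθc : ∀ x, g x ≠ 0 → ContinuousAt θ x) :
    Continuous fun x => θ x * g x := by
  refine continuous_iff_continuousAt.2 fun x => ?_
  by_cases hx : g x = 0
  · have hgx : Tendsto g (𝓝 x) (𝓝 0) := hx ▸ hg.tendsto x
    rw [ContinuousAt, hx, mul_zero]
    refine squeeze_zero_norm (fun y => ?_) (by simpa using hgx.norm)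
    rw [norm_mul]
    exact mul_le_of_le_one_left (norm_nonneg _) (hθ y)
  · exact (hθc x hx).mul hg.continuousAt

theorem exists_add_eq_of_norm_le_add (g : C₀(X, 𝕜)) {f₁ f₂ : X → ℝ} (hf₁ : Continuous f₁)
    (hf₁0 : ∀ x, 0 ≤ f₁ x) (hf₂0 : ∀ x, 0 ≤ f₂ x) (hg : ∀ x, ‖g x‖ ≤ f₁ x + f₂ x) :
    ∃ g₁ g₂ : C₀(X, 𝕜), g = g₁ + g₂ ∧ (∀ x, ‖g₁ x‖ ≤ f₁ x) ∧ (∀ x, ‖g₁ x‖ ≤ ‖g x‖) ∧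
      ∀ x, ‖g₂ x‖ ≤ f₂ x := by
  set θ : X → ℝ := fun x => min 1 (f₁ x / ‖g x‖)
  have hθ0 (x : X) : 0 ≤ θ x := le_min zero_le_one (div_nonneg (hf₁0 x) (norm_nonneg _))
  have hθ1 (x : X) : θ x ≤ 1 := min_le_left _ _
  have hθn (x : X) : ‖(θ x : 𝕜)‖ = θ x := by rw [RCLike.norm_ofReal, abs_of_nonneg (hθ0 x)]
  have hle (x : X) : ‖(θ x : 𝕜) * g x‖ ≤ ‖g x‖ := by
    rw [norm_mul, hθn]
    exact mul_le_of_le_one_left (norm_nonneg _) (hθ1 x)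
  have hcont : Continuous fun x => (θ x : 𝕜) * g x :=
    continuous_mul_of_forall_continuousAt (map_continuous g) (fun x => (hθn x).trans_le (hθ1 x))
      fun x hx => RCLike.continuous_ofReal.continuousAt.comp (continuousAt_const.min
        (hf₁.continuousAt.div (map_continuous g).norm.continuousAt (norm_ne_zero_iff.2 hx)))
  let g₁ : C₀(X, 𝕜) := ⟨⟨_, hcont⟩, squeeze_zero_norm hle (by simpa using g.zero_at_infty'.norm)⟩
  have hg₁ (x : X) : g₁ x = (θ x : 𝕜) * g x := rfl
  have hg₁n (x : X) : ‖g₁ x‖ = min ‖g x‖ (f₁ x) := by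
    rw [hg₁, norm_mul, hθn, min_mul_of_nonneg _ _ (norm_nonneg _), one_mul]
    rcases eq_or_ne ‖g x‖ 0 with h0 | h0
    · simp [h0, hf₁0 x]
    · rw [div_mul_cancel₀ _ h0]
  refine ⟨g₁, g - g₁, by abel, fun x => (hg₁n x).trans_le (min_le_right _ _), hle, fun x => ?_⟩
  have hsub : ‖g x - g₁ x‖ = ‖g x‖ - ‖g₁ x‖ := by
    rw [hg₁, norm_mul, hθn, ← one_sub_mul, ← RCLike.ofReal_one, ← RCLike.ofReal_sub, norm_mul,
      RCLike.norm_ofReal, abs_of_nonneg (sub_nonneg.2 (hθ1 x)), one_sub_mul]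
  rw [ZeroAtInftyContinuousMap.sub_apply, hsub, hg₁n]
  rcases min_cases ‖g x‖ (f₁ x) with ⟨h, -⟩ | ⟨h, -⟩ <;> rw [h]
  · simpa using hf₂0 x
  · linarith [hg x]

theorem exists_hasCompactSupport_norm_sub_le [T2Space X] (g : C₀(X, 𝕜)) {ε : ℝ} (hε : 0 < ε) :
    ∃ g₁ : C₀(X, 𝕜), HasCompactSupport g₁ ∧ ‖g - g₁‖ ≤ ε ∧ ∀ x, ‖g₁ x‖ ≤ ‖g x‖ := by
  obtain ⟨K, hK, hgK⟩ : ∃ K, IsCompact K ∧ ∀ x ∉ K, ‖g x‖ < ε := by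
    have hsmall : ∀ᶠ x in cocompact X, ‖g x‖ < ε := by
      simpa using (g.zero_at_infty'.norm).eventually (gt_mem_nhds (by simpa using hε))
    obtain ⟨K, hK, hKs⟩ := mem_cocompact.1 hsmall
    exact ⟨K, hK, fun x hx => hKs hx⟩
  obtain ⟨g₁, g₂, rfl, hg₁, hle, hg₂⟩ := exists_add_eq_of_norm_le_add g
    (f₁ := fun x => max (‖g x‖ - ε) 0) (f₂ := fun _ => ε)
    (((map_continuous g).norm.sub continuous_const).max continuous_const)
    (fun _ => le_max_right _ _) (fun _ => hε.le)
    (fun x => by linarith [le_max_left (‖g x‖ - ε) 0])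
  refine ⟨g₁, HasCompactSupport.intro hK fun x hx => ?_, ?_, hle⟩
  · simpa only [max_eq_right (sub_nonpos.2 (hgK x hx).le), norm_le_zero_iff] using hg₁ x
  · rw [add_sub_cancel_left]
    exact norm_zeroAtInfty_le hε.le hg₂

variable (ℓ : StrongDual 𝕜 C₀(X, 𝕜))

/-- The values of `|ℓ g|` over all `g` dominated by `f`; their supremum is the total variation
`|ℓ|(f)`. -/
def variationSet (f : C_c(X, ℝ≥0)) : Set ℝ≥0 :=
  {r | ∃ g : C₀(X, 𝕜), (∀ x, ‖g x‖₊ ≤ f x) ∧ r = ‖ℓ g‖₊}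

/-- The total variation `|ℓ|` of a functional `ℓ` on `C₀(X, 𝕜)`, on nonnegative functions of
compact support. -/
noncomputable def variation (f : C_c(X, ℝ≥0)) : ℝ≥0 := sSup (variationSet ℓ f)

variable {f : C_c(X, ℝ≥0)} {C : ℝ≥0}

theorem variation_le (h : ∀ g : C₀(X, 𝕜), (∀ x, ‖g x‖₊ ≤ f x) → ‖ℓ g‖₊ ≤ C) :
    variation ℓ f ≤ C := by
  refine csSup_le ⟨0, 0, by simp, by simp⟩ ?_
  rintro _ ⟨g, hg, rfl⟩
  exact h g hg

theorem nnnorm_apply_le_of_le (hC : ∀ x, f x ≤ C) {g : C₀(X, 𝕜)} (hg : ∀ x, ‖g x‖₊ ≤ f x) :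
    ‖ℓ g‖₊ ≤ ‖ℓ‖₊ * C := by
  refine (ℓ.le_opNNNorm g).trans ?_
  gcongr
  exact norm_zeroAtInfty_le C.2 fun x => (hg x).trans (hC x)

theorem le_variation {g : C₀(X, 𝕜)} (hg : ∀ x, ‖g x‖₊ ≤ f x) : ‖ℓ g‖₊ ≤ variation ℓ f := by
  obtain ⟨C, hC⟩ := f.continuous.bddAbove_range_of_hasCompactSupport f.hasCompactSupport
  refine le_csSup ⟨‖ℓ‖₊ * C, ?_⟩ ⟨g, hg, rfl⟩
  rintro _ ⟨g', hg', rfl⟩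
  exact nnnorm_apply_le_of_le ℓ (fun x => hC ⟨x, rfl⟩) hg'

theorem variation_zero : variation ℓ 0 = 0 := by
  refine le_antisymm (variation_le ℓ fun g hg => ?_) zero_le
  have : g = 0 := by
    ext x
    simpa using hg x
  simp [this]

theorem variation_smul_le {c : ℝ≥0} (hc : c ≠ 0) (f : C_c(X, ℝ≥0)) :
    variation ℓ (c • f) ≤ c * variation ℓ f := by
  have hc0 : 0 < c := pos_iff_ne_zero.2 hc
  have hcn : ‖((c : ℝ) : 𝕜)⁻¹‖₊ = c⁻¹ := NNReal.eq (by simp)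
  refine variation_le ℓ fun g hg => ?_
  have hle := le_variation ℓ (f := f) (g := ((c : ℝ) : 𝕜)⁻¹ • g) fun x => by
    rw [ZeroAtInftyContinuousMap.smul_apply, nnnorm_smul, hcn, inv_mul_le_iff₀ hc0]
    exact hg x
  rwa [map_smul, nnnorm_smul, hcn, inv_mul_le_iff₀ hc0] at hle

theorem variation_smul (c : ℝ≥0) (f : C_c(X, ℝ≥0)) :
    variation ℓ (c • f) = c * variation ℓ f := by
  rcases eq_or_ne c 0 with rfl | hc
  · rw [zero_smul, zero_mul, variation_zero]
  · refine le_antisymm (variation_smul_le ℓ hc f) ?_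
    have hinv := variation_smul_le ℓ (inv_ne_zero hc) (c • f)
    rwa [inv_smul_smul₀ hc, ← div_eq_inv_mul, le_div_iff₀' (pos_iff_ne_zero.2 hc)] at hinv

theorem variation_add_le (f₁ f₂ : C_c(X, ℝ≥0)) :
    variation ℓ (f₁ + f₂) ≤ variation ℓ f₁ + variation ℓ f₂ := by
  refine variation_le ℓ fun g hg => ?_
  obtain ⟨g₁, g₂, rfl, hg₁, -, hg₂⟩ := exists_add_eq_of_norm_le_add g
    (f₁ := fun x => f₁ x) (f₂ := fun x => f₂ x) (NNReal.continuous_coe.comp f₁.continuous)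
    (fun x => (f₁ x).2) (fun x => (f₂ x).2) hg
  rw [map_add]
  exact (nnnorm_add_le _ _).trans (add_le_add (le_variation ℓ hg₁) (le_variation ℓ hg₂))

theorem nnnorm_add_nnnorm_le_variation {f₁ f₂ : C_c(X, ℝ≥0)} {g₁ g₂ : C₀(X, 𝕜)}
    (h₁ : ∀ x, ‖g₁ x‖₊ ≤ f₁ x) (h₂ : ∀ x, ‖g₂ x‖₊ ≤ f₂ x) :
    ‖ℓ g₁‖₊ + ‖ℓ g₂‖₊ ≤ variation ℓ (f₁ + f₂) := by
  obtain ⟨c₁, hc₁, hℓ₁⟩ := RCLike.exists_norm_eq_mul_self (ℓ g₁)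
  obtain ⟨c₂, hc₂, hℓ₂⟩ := RCLike.exists_norm_eq_mul_self (ℓ g₂)
  have hc₁' : ‖c₁‖₊ = 1 := NNReal.eq hc₁
  have hc₂' : ‖c₂‖₊ = 1 := NNReal.eq hc₂
  have hle := le_variation ℓ (f := f₁ + f₂) (g := c₁ • g₁ + c₂ • g₂) fun x =>
    (nnnorm_add_le _ _).trans (add_le_add (by simpa [nnnorm_mul, hc₁'] using h₁ x)
      (by simpa [nnnorm_mul, hc₂'] using h₂ x))
  rw [map_add, map_smul, map_smul, smul_eq_mul, smul_eq_mul, ← hℓ₁, ← hℓ₂,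
    ← RCLike.ofReal_add] at hle
  refine le_trans (NNReal.coe_le_coe.1 ?_) hle
  rw [coe_nnnorm, RCLike.norm_ofReal]
  exact le_abs_self _

theorem le_variation_add (f₁ f₂ : C_c(X, ℝ≥0)) :
    variation ℓ f₁ + variation ℓ f₂ ≤ variation ℓ (f₁ + f₂) := by
  have hvar₁ (g₂ : C₀(X, 𝕜)) (h₂ : ∀ x, ‖g₂ x‖₊ ≤ f₂ x) :
      variation ℓ f₁ ≤ variation ℓ (f₁ + f₂) - ‖ℓ g₂‖₊ :=
    variation_le ℓ fun g₁ h₁ => le_tsub_of_add_le_right (nnnorm_add_nnnorm_le_variation ℓ h₁ h₂)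
  have hmono : variation ℓ f₁ ≤ variation ℓ (f₁ + f₂) := by simpa using hvar₁ 0 (by simp)
  rw [← le_tsub_iff_left hmono]
  refine variation_le ℓ fun g₂ h₂ => le_tsub_of_add_le_left ?_
  have hle : ‖ℓ g₂‖₊ ≤ variation ℓ (f₁ + f₂) := by
    simpa using nnnorm_add_nnnorm_le_variation ℓ (f₁ := f₁) (g₁ := 0) (by simp) h₂
  exact (le_tsub_iff_right hle).1 (hvar₁ g₂ h₂)

/-- The total variation as a positive linear functional. -/
noncomputable def variationLinear : C_c(X, ℝ≥0) →ₗ[ℝ≥0] ℝ≥0 where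
  toFun := variation ℓ
  map_add' f₁ f₂ := le_antisymm (variation_add_le ℓ f₁ f₂) (le_variation_add ℓ f₁ f₂)
  map_smul' := variation_smul ℓ

variable [T2Space X] [LocallyCompactSpace X] [MeasurableSpace X] [BorelSpace X]

/-- The total variation as a measure. -/
noncomputable def variationMeasure : Measure X := NNRealRMK.rieszMeasure (variationLinear ℓ)

theorem lintegral_variationMeasure (f : C_c(X, ℝ≥0)) :
    ∫⁻ x, f x ∂variationMeasure ℓ = variation ℓ f :=
  NNRealRMK.lintegral_rieszMeasure _ f

theorem variationMeasure_le_of_isCompact {K : Set X} (hK : IsCompact K) :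
    variationMeasure ℓ K ≤ ‖ℓ‖₊ := by
  obtain ⟨χ, hχK, -, hχc, hχ⟩ := exists_continuous_one_zero_of_isCompact hK isClosed_empty
    (Set.disjoint_empty K)
  let f : C_c(X, ℝ≥0) := ⟨⟨fun x => (χ x).toNNReal, by fun_prop⟩,
    hχc.comp_left Real.toNNReal_zero⟩
  have hfK (x : X) (hx : x ∈ K) : f x = 1 := by simp [f, hχK hx]
  have hf1 (x : X) : f x ≤ 1 := by simpa [f] using (hχ x).2
  calc variationMeasure ℓ K
      ≤ ∫⁻ x in K, f x ∂variationMeasure ℓ := by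
        rw [setLIntegral_congr_fun hK.measurableSet fun x hx => by rw [hfK x hx]]
        simp
    _ ≤ ∫⁻ x, f x ∂variationMeasure ℓ := setLIntegral_le_lintegral _ _
    _ = variation ℓ f := lintegral_variationMeasure ℓ f
    _ ≤ ‖ℓ‖₊ := ENNReal.coe_le_coe.2 <| variation_le ℓ fun g hg => by
        simpa using nnnorm_apply_le_of_le ℓ hf1 hg

theorem variationMeasure_univ_le : variationMeasure ℓ Set.univ ≤ ‖ℓ‖₊ := by
  have : (variationMeasure ℓ).Regular := NNRealRMK.rieszMeasure_regular _
  rw [isOpen_univ.measure_eq_iSup_isCompact]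
  exact iSup₂_le fun K _ => iSup_le fun hK => variationMeasure_le_of_isCompact ℓ hK

instance isFiniteMeasure_variationMeasure : IsFiniteMeasure (variationMeasure ℓ) :=
  ⟨(variationMeasure_univ_le ℓ).trans_lt ENNReal.coe_lt_top⟩

variable {ℓ}

theorem norm_apply_le_integral_of_hasCompactSupport {g : C₀(X, 𝕜)} (hg : HasCompactSupport g) :
    ‖ℓ g‖ ≤ ∫ x, ‖g x‖ ∂variationMeasure ℓ := by
  let f : C_c(X, ℝ≥0) := ⟨⟨fun x => ‖g x‖₊, (map_continuous g).nnnorm⟩, hg.comp_left nnnorm_zero⟩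
  have hint : Integrable g (variationMeasure ℓ) := memLp_one_iff_integrable.1 (memLp_zeroAtInfty g)
  rw [← ENNReal.ofReal_le_ofReal_iff (integral_nonneg fun x => norm_nonneg _), ofReal_norm,
    ofReal_integral_norm_eq_lintegral_enorm hint]
  calc ‖ℓ g‖ₑ ≤ variation ℓ f := ENNReal.coe_le_coe.2 (le_variation ℓ fun x => le_rfl)
    _ = ∫⁻ x, ‖g x‖ₑ ∂variationMeasure ℓ := (lintegral_variationMeasure ℓ f).symm

theorem norm_apply_le_integral_variationMeasure (g : C₀(X, 𝕜)) :
    ‖ℓ g‖ ≤ ∫ x, ‖g x‖ ∂variationMeasure ℓ := by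
  have happrox (ε : ℝ) (hε : 0 < ε) : ‖ℓ g‖ ≤ ∫ x, ‖g x‖ ∂variationMeasure ℓ + ‖ℓ‖ * ε := by
    obtain ⟨g₁, hg₁, hsub, hle⟩ := exists_hasCompactSupport_norm_sub_le g hε
    calc ‖ℓ g‖ = ‖ℓ g₁ + ℓ (g - g₁)‖ := by rw [← map_add, add_sub_cancel]
      _ ≤ ‖ℓ g₁‖ + ‖ℓ (g - g₁)‖ := norm_add_le _ _
      _ ≤ ∫ x, ‖g x‖ ∂variationMeasure ℓ + ‖ℓ‖ * ε := by
        refine add_le_add ((norm_apply_le_integral_of_hasCompactSupport hg₁).trans ?_)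
          (ℓ.le_of_opNorm_le_of_le le_rfl hsub)
        exact integral_mono (memLp_one_iff_integrable.1 (memLp_zeroAtInfty g₁)).norm
          (memLp_one_iff_integrable.1 (memLp_zeroAtInfty g)).norm hle
  have hlim : Tendsto (fun ε : ℝ => ∫ x, ‖g x‖ ∂variationMeasure ℓ + ‖ℓ‖ * ε) (𝓝[>] 0)
      (𝓝 (∫ x, ‖g x‖ ∂variationMeasure ℓ + ‖ℓ‖ * 0)) :=
    (Continuous.tendsto (by fun_prop) 0).mono_left nhdsWithin_le_nhds
  rw [mul_zero, add_zero] at hlim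
  exact ge_of_tendsto hlim (eventually_mem_nhdsWithin.mono happrox)

/- Since `|ℓ g| ≤ ∫ |g| d|ℓ|`, the functional `ℓ` extends to `L¹(|ℓ|)`, whose dual is known. -/
theorem exists_integrable_forall_apply_eq_integral (ℓ : StrongDual 𝕜 C₀(X, 𝕜)) :
    ∃ h : X → 𝕜, Integrable h (variationMeasure ℓ) ∧ ∫ x, ‖h x‖ ∂variationMeasure ℓ ≤ ‖ℓ‖ ∧
      ∀ g : C₀(X, 𝕜), ℓ g = ∫ x, g x * h x ∂variationMeasure ℓ := by
  have hint (g : C₀(X, 𝕜)) : Integrable g (variationMeasure ℓ) :=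
    memLp_one_iff_integrable.1 (memLp_zeroAtInfty g)
  let ι : C₀(X, 𝕜) →ₗ[𝕜] Lp 𝕜 1 (variationMeasure ℓ) :=
    { toFun g := (hint g).toL1 g
      map_add' g₁ g₂ := Integrable.toL1_add _ _ (hint g₁) (hint g₂)
      map_smul' c g := Integrable.toL1_smul _ (hint g) c }
  obtain ⟨f, hf, hfℓ⟩ := exists_strongDual_apply_eq_of_norm_le ι (ℓ : C₀(X, 𝕜) →ₗ[𝕜] 𝕜)
    zero_le_one fun g => by
      rw [one_mul]
      exact (norm_apply_le_integral_variationMeasure g).trans_eq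
        (L1.norm_of_fun_eq_integral_norm (hint g)).symm
  obtain ⟨h, hh, hnorm, hfh⟩ := exists_density_of_strongDual_Lp_one f
  refine ⟨h, hh, ?_, fun g => (hfℓ g).symm.trans (hfh g (memLp_zeroAtInfty g))⟩
  calc ∫ x, ‖h x‖ ∂variationMeasure ℓ
      ≤ ‖f‖ * (variationMeasure ℓ).real Set.univ := hnorm
    _ ≤ 1 * ‖ℓ‖ := by
      gcongr
      exact ENNReal.toReal_mono ENNReal.coe_ne_top (variationMeasure_univ_le ℓ)
    _ = ‖ℓ‖ := one_mul _

end Riesz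

/-! ### Exponentially weighted spaces -/

theorem expWeight_absolutelyContinuous (γ : ℝ) : expWeight γ ≪ volume :=
  withDensity_absolutelyContinuous _ _

theorem absolutelyContinuous_expWeight (γ : ℝ) : volume ≪ expWeight γ :=
  withDensity_absolutelyContinuous' (by fun_prop) (Eventually.of_forall fun k => by
    simp [Real.exp_pos])

theorem aestronglyMeasurable_expWeight_iff {γ : ℝ} {f : ℝ → ℂ} :
    AEStronglyMeasurable f (expWeight γ) ↔ AEStronglyMeasurable f volume :=
  ⟨fun h => h.mono_ac (absolutelyContinuous_expWeight γ),
    fun h => h.mono_ac (expWeight_absolutelyContinuous γ)⟩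

theorem eLpNorm_expWeight (γ : ℝ) (f : ℝ → ℂ) :
    eLpNorm f 2 (expWeight γ) =
      eLpNorm (fun k => (Real.exp (-γ * k / 2) : ℂ) * f k) 2 volume := by
  rw [eLpNorm_eq_lintegral_rpow_enorm_toReal (by simp) (by simp),
    eLpNorm_eq_lintegral_rpow_enorm_toReal (by simp) (by simp), expWeight,
    lintegral_withDensity_eq_lintegral_mul_non_measurable _ (by fun_prop)
      (Eventually.of_forall fun _ => ENNReal.ofReal_lt_top)]
  congr 1
  refine lintegral_congr fun k => ?_
  have henorm : ‖(Real.exp (-γ * k / 2) : ℂ)‖ₑ = ENNReal.ofReal (Real.exp (-γ * k / 2)) := by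
    rw [← ofReal_norm, Complex.norm_real, Real.norm_eq_abs, Real.abs_exp]
  simp only [Pi.mul_apply, enorm_mul, henorm, ENNReal.toReal_ofNat, ENNReal.rpow_ofNat, mul_pow]
  rw [← ENNReal.ofReal_pow (Real.exp_pos _).le, ← Real.exp_nat_mul]
  congr 3
  push_cast
  ring

theorem memL2_iff_memLp_exp_mul {γ : ℝ} {f : ℝ → ℂ} :
    MemL2 γ f ↔ MemLp (fun k => (Real.exp (-γ * k / 2) : ℂ) * f k) 2 volume := by
  unfold MemL2 MemLp
  rw [eLpNorm_expWeight, aestronglyMeasurable_expWeight_iff]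
  refine and_congr_left fun _ => ⟨fun h => (by fun_prop : Continuous fun k : ℝ =>
    (Real.exp (-γ * k / 2) : ℂ)).aestronglyMeasurable.mul h, fun h => ?_⟩
  refine ((by fun_prop : Continuous fun k : ℝ =>
    (Real.exp (γ * k / 2) : ℂ)).aestronglyMeasurable.mul h).congr
    (Eventually.of_forall fun k => ?_)
  simp only [Pi.mul_apply, ← mul_assoc, ← Complex.ofReal_mul, ← Real.exp_add]
  rw [show γ * k / 2 + -γ * k / 2 = 0 by ring]
  simp

theorem normL2_nonneg (γ : ℝ) (f : ℝ → ℂ) : 0 ≤ normL2 γ f := ENNReal.toReal_nonneg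

theorem MemL2.aestronglyMeasurable {γ : ℝ} {f : ℝ → ℂ} (h : MemL2 γ f) :
    AEStronglyMeasurable f volume :=
  aestronglyMeasurable_expWeight_iff.1 h.1

theorem MemL2.congr_ae {γ : ℝ} {f g : ℝ → ℂ} (h : MemL2 γ f) (hfg : f =ᵐ[volume] g) :
    MemL2 γ g :=
  MemLp.ae_eq ((expWeight_absolutelyContinuous γ).ae_eq hfg) h

theorem normL2_congr_ae {γ : ℝ} {f g : ℝ → ℂ} (hfg : f =ᵐ[volume] g) :
    normL2 γ f = normL2 γ g := by
  unfold normL2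
  rw [eLpNorm_congr_ae ((expWeight_absolutelyContinuous γ).ae_eq hfg)]

theorem exp_mul_exp_cancel (γ k : ℝ) (a b : ℂ) :
    ((Real.exp (-(-γ) * k / 2) : ℂ) * a) * ((Real.exp (-γ * k / 2) : ℂ) * b) = a * b := by
  have : (Real.exp (-(-γ) * k / 2) : ℂ) * (Real.exp (-γ * k / 2) : ℂ) = 1 := by
    rw [← Complex.ofReal_mul, ← Real.exp_add, show -(-γ) * k / 2 + -γ * k / 2 = 0 by ring]
    simp
  linear_combination a * b * this

theorem MemL2.integrable_mul {γ : ℝ} {u w : ℝ → ℂ} (hu : MemL2 (-γ) u) (hw : MemL2 γ w) :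
    Integrable fun k => u k * w k := by
  have hmul := MemLp.integrable_mul (memL2_iff_memLp_exp_mul.1 hu) (memL2_iff_memLp_exp_mul.1 hw)
  exact hmul.congr (Eventually.of_forall fun k => exp_mul_exp_cancel γ k _ _)

theorem MemL2.norm_integral_mul_le {γ : ℝ} {u w : ℝ → ℂ} (hu : MemL2 (-γ) u)
    (hw : MemL2 γ w) : ‖∫ k, u k * w k‖ ≤ normL2 (-γ) u * normL2 γ w := by
  have hu' := memL2_iff_memLp_exp_mul.1 hu
  have hw' := memL2_iff_memLp_exp_mul.1 hw
  have h_holder := eLpNorm_smul_le_mul_eLpNorm (p := 2) (q := 2) (r := 1) hw'.1 hu'.1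
  have h_triangle : ‖∫ k, u k * w k‖ ≤ (eLpNorm (fun k => u k * w k) 1 volume).toReal := by
    refine (norm_integral_le_integral_norm _).trans_eq ?_
    rw [integral_norm_eq_lintegral_enorm (hu.integrable_mul hw).1, eLpNorm_one_eq_lintegral_enorm]
  refine h_triangle.trans ?_
  unfold normL2
  rw [← ENNReal.toReal_mul, eLpNorm_expWeight, eLpNorm_expWeight]
  refine ENNReal.toReal_mono (ENNReal.mul_ne_top hu'.2.ne hw'.2.ne) ?_
  refine le_trans (le_of_eq ?_) h_holder
  congr 1
  funext k
  exact (exp_mul_exp_cancel γ k _ _).symm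

theorem MemL2.locallyIntegrable {γ : ℝ} {u : ℝ → ℂ} (hu : MemL2 γ u) :
    LocallyIntegrable u := by
  have hweighted := (memL2_iff_memLp_exp_mul.1 hu).locallyIntegrable (by norm_num)
  have hsmul := LocallyIntegrableOn.continuousOn_smul isClosed_univ.isLocallyClosed
    (locallyIntegrableOn_univ.2 hweighted)
    (g := fun k : ℝ => (Real.exp (γ * k / 2) : ℂ)) (by fun_prop)
  refine (locallyIntegrableOn_univ.1 hsmul).congr (Eventually.of_forall fun k => ?_)
  simp only [smul_eq_mul, ← mul_assoc, ← Complex.ofReal_mul, ← Real.exp_add]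
  rw [show γ * k / 2 + -γ * k / 2 = 0 by ring]
  simp

/-! ### The Fourier transform -/

/-- The Fourier transform `k ↦ ∫ f(x) e^{-ikx} dμ(x)` of the complex measure `f μ`. -/
noncomputable def fourierMeasure (μ : Measure ℝ) (f : ℝ → ℂ) (k : ℝ) : ℂ :=
  ∫ x, f x * Complex.exp (-(Complex.I * k * x)) ∂μ

theorem norm_cexp_neg_I_mul (k x : ℝ) : ‖Complex.exp (-(Complex.I * k * x))‖ = 1 := by
  rw [show -(Complex.I * k * x) = ((-(k * x) : ℝ) : ℂ) * Complex.I by push_cast; ring]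
  exact Complex.norm_exp_ofReal_mul_I _

theorem integrable_mul_cexp {μ : Measure ℝ} {f : ℝ → ℂ} (hf : Integrable f μ) (k : ℝ) :
    Integrable (fun x : ℝ => f x * Complex.exp (-(Complex.I * k * x))) μ :=
  hf.mul_bdd (c := 1) (by fun_prop)
    (Eventually.of_forall fun x => (norm_cexp_neg_I_mul k x).le)

theorem norm_fourierMeasure_le (μ : Measure ℝ) (f : ℝ → ℂ) (k : ℝ) :
    ‖fourierMeasure μ f k‖ ≤ ∫ x, ‖f x‖ ∂μ := by
  refine (norm_integral_le_integral_norm _).trans_eq ?_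
  simp only [norm_mul, norm_cexp_neg_I_mul, mul_one]

theorem continuous_fourierMeasure {μ : Measure ℝ} {f : ℝ → ℂ} (hf : Integrable f μ) :
    Continuous (fourierMeasure μ f) := by
  refine continuous_of_dominated (bound := fun x => ‖f x‖)
    (fun k => (integrable_mul_cexp hf k).1) (fun k => Eventually.of_forall fun x => ?_) hf.norm
    (Eventually.of_forall fun x => by fun_prop)
  simp only [norm_mul, norm_cexp_neg_I_mul, mul_one, le_refl]

theorem integral_fourierMeasure_mul {μ ν : Measure ℝ} [SFinite μ] [SFinite ν] {f φ : ℝ → ℂ}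
    (hf : Integrable f μ) (hφ : Integrable φ ν) :
    ∫ k, fourierMeasure μ f k * φ k ∂ν = ∫ x, f x * fourierMeasure ν φ x ∂μ := by
  have hint : Integrable (Function.uncurry fun (k : ℝ) (x : ℝ) =>
      f x * Complex.exp (-(Complex.I * k * x)) * φ k) (ν.prod μ) := by
    refine ((hφ.mul_prod hf).mul_bdd (c := 1)
      (g := fun p : ℝ × ℝ => Complex.exp (-(Complex.I * p.1 * p.2))) (by fun_prop)
      (Eventually.of_forall fun p => (norm_cexp_neg_I_mul _ _).le)).congr
      (Eventually.of_forall fun p => ?_)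
    simp only [Function.uncurry]
    ring
  simp_rw [fourierMeasure, ← integral_mul_const]
  rw [integral_integral_swap hint]
  refine integral_congr_ae (Eventually.of_forall fun x => ?_)
  simp only [← integral_const_mul]
  refine integral_congr_ae (Eventually.of_forall fun k => ?_)
  simp only
  rw [show Complex.I * (x : ℂ) * k = Complex.I * k * x by ring]
  ring

theorem norm_fourier_le (f : ℝ → ℂ) (k : ℝ) : ‖fourier f k‖ ≤ ∫ x, ‖f x‖ :=
  norm_fourierMeasure_le volume f k

theorem continuous_fourier {f : ℝ → ℂ} (hf : Integrable f) : Continuous (fourier f) :=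
  continuous_fourierMeasure hf

theorem fourier_congr_ae {f g : ℝ → ℂ} (h : f =ᵐ[volume] g) : fourier f = fourier g :=
  funext fun k => integral_congr_ae (h.mono fun x hx => by simp only [hx])

theorem fourier_eq_fourier_div (f : ℝ → ℂ) (k : ℝ) :
    fourier f k = FourierTransform.fourier f (k / (2 * Real.pi)) := by
  rw [Real.fourier_real_eq_integral_exp_smul, fourier]
  refine integral_congr_ae (Eventually.of_forall fun x => ?_)
  simp only [smul_eq_mul]
  rw [mul_comm]
  congr 2
  have : (Real.pi : ℂ) ≠ 0 := by exact_mod_cast Real.pi_ne_zero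
  push_cast
  field_simp

theorem integral_fourier_mul {f φ : ℝ → ℂ} (hf : Integrable f) (hφ : Integrable φ) :
    ∫ k, fourier f k * φ k = ∫ x, f x * fourier φ x :=
  integral_fourierMeasure_mul hf hφ

theorem integrable_fourierTransform {f : ℝ → ℂ} (h : Integrable (fourier f)) :
    Integrable (FourierTransform.fourier f) := by
  refine (h.comp_mul_right' (R := 2 * Real.pi) (by positivity)).congr
    (Eventually.of_forall fun k => ?_)
  simp only [fourier_eq_fourier_div]
  field_simp

theorem fourier_inversion {f : ℝ → ℂ} (hc : Continuous f) (hf : Integrable f)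
    (hf' : Integrable (fourier f)) (k : ℝ) :
    fourier (fun x => (2 * Real.pi : ℂ)⁻¹ * fourier f (-x)) k = f k := by
  have hinv := congrFun (hc.fourier_fourierInv_eq hf (integrable_fourierTransform hf')) k
  set F : ℝ → ℂ := fun x => fourier f (-x) * Complex.exp (-(Complex.I * k * x)) with hF
  have hscale := Measure.integral_comp_mul_right F (2 * Real.pi)
  rw [abs_of_pos (by positivity)] at hscale
  calc fourier (fun x => (2 * Real.pi : ℂ)⁻¹ * fourier f (-x)) k
      = ((2 * Real.pi)⁻¹ : ℝ) • ∫ x, F x := by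
        simp only [fourier, hF, mul_assoc, integral_const_mul, Complex.real_smul]
        push_cast
        rfl
    _ = ∫ x, F (x * (2 * Real.pi)) := hscale.symm
    _ = f k := by
        rw [← hinv, Real.fourier_real_eq_integral_exp_smul]
        refine integral_congr_ae (Eventually.of_forall fun x => ?_)
        simp only [hF, smul_eq_mul, Real.fourierInv_eq_fourier_neg, fourier_eq_fourier_div]
        rw [mul_comm]
        congr 2
        · push_cast; ring
        · field_simp

theorem integral_fourier {f : ℝ → ℂ} (hc : Continuous f) (hf : Integrable f)
    (hf' : Integrable (fourier f)) : ∫ x, fourier f x = 2 * Real.pi * f 0 := by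
  rw [← fourier_inversion hc hf hf' 0, fourier]
  simp only [Complex.ofReal_zero, mul_zero, zero_mul, neg_zero, Complex.exp_zero, mul_one,
    integral_const_mul]
  rw [integral_neg_eq_self (fun x => fourier f x)]
  have : (Real.pi : ℂ) ≠ 0 := by exact_mod_cast Real.pi_ne_zero
  field_simp

/-! ### Test functions -/

theorem IsTestFunction.continuous {φ : ℝ → ℂ} (h : IsTestFunction φ) : Continuous φ :=
  h.1.continuous

theorem IsTestFunction.integrable {φ : ℝ → ℂ} (h : IsTestFunction φ) : Integrable φ :=
  h.continuous.integrable_of_hasCompactSupport h.2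

theorem IsTestFunction.integrable_fourier {φ : ℝ → ℂ} (h : IsTestFunction φ) :
    Integrable (fourier φ) := by
  have hschwartz : Integrable (FourierTransform.fourier (h.2.toSchwartzMap h.1 : ℝ → ℂ)) := by
    rw [← SchwartzMap.fourier_coe]
    exact SchwartzMap.integrable _
  exact (hschwartz.comp_div (R := 2 * Real.pi) (by positivity)).congr
    (Eventually.of_forall fun k => (fourier_eq_fourier_div φ k).symm)

theorem isTestFunction_ofReal {g : ℝ → ℝ} (hg : ContDiff ℝ ∞ g) (hgc : HasCompactSupport g) :
    IsTestFunction fun x => (g x : ℂ) :=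
  ⟨Complex.ofRealCLM.contDiff.comp hg, hgc.comp_left Complex.ofReal_zero⟩

theorem exists_isTestFunction_eq_one : ∃ φ : ℝ → ℂ, IsTestFunction φ ∧ φ 0 = 1 := by
  let b : ContDiffBump (0 : ℝ) := ⟨1, 2, by norm_num, by norm_num⟩
  have hb : b 0 = 1 := b.one_of_mem_closedBall (by simp [b.rIn_pos.le])
  exact ⟨_, isTestFunction_ofReal b.contDiff b.hasCompactSupport, by rw [hb, Complex.ofReal_one]⟩

theorem ae_eq_zero_of_fourier_ae_eq_zero {f : ℝ → ℂ} (hf : Integrable f)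
    (h0 : fourier f =ᵐ[volume] 0) : f =ᵐ[volume] 0 := by
  refine ae_eq_zero_of_integral_contDiff_smul_eq_zero hf.locallyIntegrable fun g hg hgc => ?_
  have hφ := isTestFunction_ofReal hg hgc
  set ψ : ℝ → ℂ := fun x => (2 * Real.pi : ℂ)⁻¹ * fourier (fun x => (g x : ℂ)) (-x)
  have hψ : fourier ψ = fun x => (g x : ℂ) :=
    funext fun k => fourier_inversion hφ.continuous hφ.integrable hφ.integrable_fourier k
  calc ∫ x, g x • f x = ∫ x, f x * fourier ψ x := by
        simp only [hψ, Complex.real_smul, mul_comm]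
    _ = ∫ k, fourier f k * ψ k :=
        (integral_fourier_mul hf (hφ.integrable_fourier.comp_neg.const_mul _)).symm
    _ = 0 := integral_eq_zero_of_ae (h0.mono fun k hk => by simp [hk])

/-! ### Densities of complex measures -/

section Density

variable {α E : Type*} [MeasurableSpace α] [NormedAddCommGroup E] [NormedSpace ℝ E]
  {ν μ : Measure α} {h : α → E}

theorem setIntegral_eq_zero_of_forall_isCompact [TopologicalSpace α] [T2Space α]
    [OpensMeasurableSpace α] [IsFiniteMeasure ν] [ν.InnerRegularCompactLTTop]
    (hh : Integrable h ν) {B : Set α} (hB : MeasurableSet B)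
    (hcompact : ∀ K ⊆ B, IsCompact K → ∫ x in K, h x ∂ν = 0) : ∫ x in B, h x ∂ν = 0 := by
  have happrox (n : ℕ) : ∃ K ⊆ B, IsCompact K ∧ ν (B \ K) < ((n : ℝ≥0∞) + 1)⁻¹ :=
    hB.exists_isCompact_sdiff_lt (measure_ne_top ν B) (by simp)
  choose K hKB hK hKν using happrox
  have hν : Tendsto (fun n => ν (B \ K n)) atTop (𝓝 0) :=
    tendsto_of_tendsto_of_tendsto_of_le_of_le tendsto_const_nhds
      (by simpa using (tendsto_add_atTop_iff_nat 1).2 ENNReal.tendsto_inv_nat_nhds_zero)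
      (fun n => zero_le) (fun n => (hKν n).le)
  refine tendsto_nhds_unique tendsto_const_nhds
    ((hh.tendsto_setIntegral_nhds_zero hν).congr fun n => ?_)
  rw [setIntegral_sdiff (hK n).measurableSet hh.integrableOn (hKB n),
    hcompact _ (hKB n) (hK n), sub_zero]

theorem ae_singularPart_eq_zero_of_forall_setIntegral [CompleteSpace E]
    [SigmaFinite ν] [SigmaFinite μ] (hh : Integrable h ν)
    (hnull : ∀ B, MeasurableSet B → μ B = 0 → ∫ x in B, h x ∂ν = 0) :
    h =ᵐ[ν.singularPart μ] 0 := by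
  obtain ⟨N, hN, hNsing, hNμ⟩ := ν.mutuallySingular_singularPart μ
  have hrestrict : ν.restrict Nᶜ = ν.singularPart μ := by
    conv_lhs => rw [ν.haveLebesgueDecomposition_add μ, Measure.restrict_add]
    rw [Measure.restrict_eq_zero.2 (withDensity_absolutelyContinuous _ _ hNμ), add_zero,
      Measure.restrict_eq_self_of_ae_mem]
    exact measure_eq_zero_iff_ae_notMem.1 hNsing
  refine (hh.mono_measure (ν.singularPart_le μ)).ae_eq_zero_of_forall_setIntegral_eq_zero
    fun B hB _ => ?_
  rw [← hrestrict, Measure.restrict_restrict hB]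
  exact hnull _ (hB.inter hN.compl) (measure_mono_null Set.inter_subset_right hNμ)

theorem exists_integrable_density_of_forall_setIntegral [SigmaFinite ν] [SigmaFinite μ]
    {h : α → ℂ} (hh : Integrable h ν)
    (hnull : ∀ B, MeasurableSet B → μ B = 0 → ∫ x in B, h x ∂ν = 0) :
    ∃ m : α → ℂ, Integrable m μ ∧ ∫ x, ‖m x‖ ∂μ ≤ ∫ x, ‖h x‖ ∂ν ∧
      ∀ g : α → ℂ, Integrable (fun x => g x * h x) ν →
        ∫ x, g x * h x ∂ν = ∫ x, g x * m x ∂μ := by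
  have hsing := ae_singularPart_eq_zero_of_forall_setIntegral hh hnull
  have hmeas := ν.measurable_rnDeriv μ
  have hle : μ.withDensity (ν.rnDeriv μ) ≤ ν := ν.withDensity_rnDeriv_le μ
  refine ⟨fun x => (ν.rnDeriv μ x).toReal • h x,
    (integrable_withDensity_iff_integrable_smul' hmeas (ν.rnDeriv_lt_top μ)).1
      (hh.mono_measure hle), ?_, fun g hg => ?_⟩
  · calc ∫ x, ‖(ν.rnDeriv μ x).toReal • h x‖ ∂μ
        = ∫ x, ‖h x‖ ∂μ.withDensity (ν.rnDeriv μ) := by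
          rw [integral_withDensity_eq_integral_toReal_smul hmeas (ν.rnDeriv_lt_top μ)]
          simp only [norm_smul, Real.norm_of_nonneg ENNReal.toReal_nonneg, smul_eq_mul]
      _ ≤ ∫ x, ‖h x‖ ∂ν :=
          integral_mono_measure hle (Eventually.of_forall fun x => norm_nonneg _) hh.norm
  · calc ∫ x, g x * h x ∂ν
        = ∫ x, g x * h x ∂ν.singularPart μ + ∫ x, g x * h x ∂μ.withDensity (ν.rnDeriv μ) := by
          conv_lhs => rw [ν.haveLebesgueDecomposition_add μ]
          exact integral_add_measure (hg.mono_measure (ν.singularPart_le μ)) (hg.mono_measure hle)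
      _ = ∫ x, g x * ((ν.rnDeriv μ x).toReal • h x) ∂μ := by
          rw [integral_eq_zero_of_ae (hsing.mono fun x hx => by simp [hx]), zero_add,
            integral_withDensity_eq_integral_toReal_smul hmeas (ν.rnDeriv_lt_top μ)]
          simp only [mul_smul_comm]

end Density

/-! ### Half-line transforms and powers -/

section HalfLine

variable {α : Type*} [MeasurableSpace α] {ν : Measure α} {h G : α → ℂ}

theorem integrable_mul_pow_of_norm_le (hh : Integrable h ν) (hG : AEStronglyMeasurable G ν)
    {A : ℝ} (hA : ∀ x, ‖G x‖ ≤ A) (p : ℕ) : Integrable (fun x => h x * G x ^ p) ν :=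
  hh.mul_bdd (c := A ^ p) (hG.pow p) (Eventually.of_forall fun x => by
    rw [norm_pow]
    exact pow_le_pow_left₀ (norm_nonneg _) (hA x) p)

theorem hasSum_integral_mul_pow (hh : Integrable h ν) (hG : AEStronglyMeasurable G ν)
    {A : ℝ} (hA : ∀ x, ‖G x‖ ≤ A) (z : ℂ) :
    HasSum (fun p : ℕ => z ^ p / p.factorial * ∫ x, h x * G x ^ p ∂ν)
      (∫ x, h x * Complex.exp (z * G x) ∂ν) := by
  have hint (p : ℕ) : Integrable (fun x => z ^ p / p.factorial * (h x * G x ^ p)) ν :=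
    (integrable_mul_pow_of_norm_le hh hG hA p).const_mul _
  have hbound (p : ℕ) (x : α) :
      ‖z ^ p / p.factorial * (h x * G x ^ p)‖ ≤ ‖h x‖ * ((‖z‖ * A) ^ p / p.factorial) := by
    calc ‖z ^ p / p.factorial * (h x * G x ^ p)‖
        = ‖h x‖ * ((‖z‖ * ‖G x‖) ^ p / p.factorial) := by
          simp only [norm_mul, norm_div, norm_pow, Complex.norm_natCast]
          ring
      _ ≤ ‖h x‖ * ((‖z‖ * A) ^ p / p.factorial) := by
          gcongr
          exact hA x
  have hsummable : Summable fun p : ℕ => ∫ x, ‖z ^ p / p.factorial * (h x * G x ^ p)‖ ∂ν := by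
    refine Summable.of_nonneg_of_le (fun p => integral_nonneg fun x => norm_nonneg _) (fun p => ?_)
      ((Real.summable_pow_div_factorial (‖z‖ * A)).mul_left (∫ x, ‖h x‖ ∂ν))
    rw [← integral_mul_const]
    exact integral_mono (hint p).norm (hh.norm.mul_const _) (hbound p)
  have hexp (x : α) :
      ∑' p : ℕ, z ^ p / p.factorial * (h x * G x ^ p) = h x * Complex.exp (z * G x) := by
    have hseries := (NormedSpace.expSeries_div_hasSum_exp (z * G x)).mul_left (h x)
    rw [← Complex.exp_eq_exp_ℂ] at hseries
    refine (hseries.congr_fun fun p => ?_).tsum_eq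
    rw [mul_pow]
    ring
  simpa only [hexp, integral_const_mul] using
    hasSum_integral_of_summable_integral_norm hint hsummable

theorem norm_integral_mul_exp_sub_le (hh : Integrable h ν) (hG : AEStronglyMeasurable G ν)
    {A : ℝ} (hA : ∀ x, ‖G x‖ ≤ A) {D r : ℝ}
    (hpow : ∀ p : ℕ, ‖∫ x, h x * G x ^ (p + 1) ∂ν‖ ≤ D * r ^ p) (z : ℂ) :
    ‖∫ x, h x * Complex.exp (z * G x) ∂ν - ∫ x, h x ∂ν‖ ≤ D * ‖z‖ * Real.exp (‖z‖ * r) := by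
  have htail := (hasSum_nat_add_iff' 1).2 (hasSum_integral_mul_pow hh hG hA z)
  simp only [Finset.range_one, Finset.sum_singleton, pow_zero, Nat.factorial_zero, Nat.cast_one,
    div_one, mul_one, one_mul] at htail
  rw [← htail.tsum_eq]
  have hexp := (NormedSpace.expSeries_div_hasSum_exp (‖z‖ * r)).mul_left (D * ‖z‖)
  rw [← Real.exp_eq_exp_ℝ] at hexp
  refine tsum_of_norm_bounded hexp fun p => ?_
  rw [norm_mul, norm_div, norm_pow, Complex.norm_natCast]
  calc ‖z‖ ^ (p + 1) / ((p + 1).factorial : ℝ) * ‖∫ x, h x * G x ^ (p + 1) ∂ν‖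
      ≤ ‖z‖ ^ (p + 1) / (p.factorial : ℝ) * (D * r ^ p) := by
        gcongr
        · exact p.le_succ
        · exact hpow p
    _ = D * ‖z‖ * ((‖z‖ * r) ^ p / p.factorial) := by
        rw [mul_pow]
        ring

/-- The Fourier–Laplace transform of a function on the half-line `(0, ∞)`. -/
noncomputable abbrev halfLineTransform (a : ℝ → ℂ) : ℝ → ℂ :=
  fourierMeasure (volume.restrict (Set.Ioi 0)) a

theorem fourierMeasure_mul_cexp (μ : Measure ℝ) (f : ℝ → ℂ) (s k : ℝ) :
    fourierMeasure μ (fun x => f x * Complex.exp (-(Complex.I * s * x))) k =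
      fourierMeasure μ f (s + k) := by
  refine integral_congr_ae (Eventually.of_forall fun x => ?_)
  simp only [mul_assoc, ← Complex.exp_add]
  congr 2
  push_cast
  ring

variable {ν : Measure ℝ} {h a : ℝ → ℂ} {σ b : ℝ}

theorem fourierMeasure_mul_halfLineTransform [SFinite ν] (hh : Integrable h ν)
    (ha : IntegrableOn a (Set.Ioi 0)) (s : ℝ) :
    fourierMeasure ν (fun x => h x * halfLineTransform a x) s =
      ∫ t in Set.Ioi (0 : ℝ), a t * fourierMeasure ν h (s + t) := by
  have hduality := integral_fourierMeasure_mul (integrable_mul_cexp hh s) ha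
  simp only [fourierMeasure_mul_cexp] at hduality
  simp only [mul_comm (a _), hduality]
  exact integral_congr_ae (Eventually.of_forall fun x => mul_right_comm _ _ _)

theorem norm_fourierMeasure_mul_halfLineTransform_le_of_integrableOn [SFinite ν]
    (hh : Integrable h ν) (ha : IntegrableOn a (Set.Ioi 0)) (hσ : ∀ t > 0, ‖a t‖ ≤ σ) (hb : 0 ≤ b)
    (hT : IntegrableOn (fun r => Real.exp (b * r) * ‖fourierMeasure ν h r‖) (Set.Ioi 0))
    {s : ℝ} (hs : 0 ≤ s) :
    ‖fourierMeasure ν (fun x => h x * halfLineTransform a x) s‖ ≤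
      σ * (∫ r in Set.Ioi 0, Real.exp (b * r) * ‖fourierMeasure ν h r‖) * Real.exp (-b * s) := by
  set W : ℝ → ℝ := fun r => Real.exp (b * r) * ‖fourierMeasure ν h r‖
  have hσ0 : 0 ≤ σ := (norm_nonneg _).trans (hσ 1 one_pos)
  have hpreimage : (fun t => s + t) ⁻¹' Set.Ioi s = Set.Ioi 0 := by
    ext t
    simp
  have hmp := measurePreserving_add_left volume s
  have hemb := measurableEmbedding_addLeft s
  have hWs : IntegrableOn (fun t => W (s + t)) (Set.Ioi 0) := by
    rw [← hpreimage]
    exact (hmp.integrableOn_comp_preimage hemb).2 (hT.mono_set (Set.Ioi_subset_Ioi hs))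
  rw [fourierMeasure_mul_halfLineTransform hh ha]
  calc ‖∫ t in Set.Ioi 0, a t * fourierMeasure ν h (s + t)‖
      ≤ ∫ t in Set.Ioi 0, σ * Real.exp (-b * s) * W (s + t) := by
        refine norm_integral_le_of_norm_le (hWs.const_mul _) ?_
        refine ae_restrict_of_forall_mem measurableSet_Ioi fun t (ht : 0 < t) => ?_
        rw [norm_mul, mul_assoc, ← mul_assoc (Real.exp _), ← Real.exp_add]
        gcongr
        · exact hσ t ht
        · refine le_mul_of_one_le_left (norm_nonneg _) (Real.one_le_exp ?_)
          nlinarith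
    _ = σ * Real.exp (-b * s) * ∫ r in Set.Ioi s, W r := by
        rw [integral_const_mul, ← hmp.setIntegral_preimage_emb hemb W, hpreimage]
    _ ≤ σ * Real.exp (-b * s) * ∫ r in Set.Ioi 0, W r := by
        gcongr ?_ * ?_
        exact setIntegral_mono_set hT (Eventually.of_forall fun r => by positivity)
          (Set.Ioi_subset_Ioi hs).eventuallyLE
    _ = σ * (∫ r in Set.Ioi 0, W r) * Real.exp (-b * s) := mul_right_comm _ _ _

theorem norm_fourierMeasure_mul_halfLineTransform_le_of_norm_le [SFinite ν]
    (hh : Integrable h ν) (ha : IntegrableOn a (Set.Ioi 0)) (hσ : ∀ t > 0, ‖a t‖ ≤ σ) (hb : 0 < b)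
    {D : ℝ} (hD : ∀ r ≥ 0, ‖fourierMeasure ν h r‖ ≤ D * Real.exp (-b * r)) {s : ℝ} (hs : 0 ≤ s) :
    ‖fourierMeasure ν (fun x => h x * halfLineTransform a x) s‖ ≤
      D * (σ / b) * Real.exp (-b * s) := by
  have hσ0 : 0 ≤ σ := (norm_nonneg _).trans (hσ 1 one_pos)
  rw [fourierMeasure_mul_halfLineTransform hh ha]
  calc ‖∫ t in Set.Ioi 0, a t * fourierMeasure ν h (s + t)‖
      ≤ ∫ t in Set.Ioi 0, σ * (D * Real.exp (-b * s)) * Real.exp (-b * t) := by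
        refine norm_integral_le_of_norm_le ((exp_neg_integrableOn_Ioi 0 hb).const_mul _) ?_
        refine ae_restrict_of_forall_mem measurableSet_Ioi fun t (ht : 0 < t) => ?_
        rw [norm_mul, mul_assoc, mul_assoc, ← Real.exp_add, ← mul_add]
        exact mul_le_mul (hσ t ht) (hD _ (by linarith)) (norm_nonneg _) hσ0
    _ = σ * (D * Real.exp (-b * s)) * b⁻¹ := by
        rw [integral_const_mul, integral_exp_mul_Ioi (neg_neg_of_pos hb)]
        simp
    _ = D * (σ / b) * Real.exp (-b * s) := by ring

variable [IsFiniteMeasure ν]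

theorem norm_fourierMeasure_mul_halfLineTransform_pow_le (hh : Integrable h ν)
    (ha : IntegrableOn a (Set.Ioi 0)) (hσ : ∀ t > 0, ‖a t‖ ≤ σ) (hb : 0 < b)
    (hT : IntegrableOn (fun r => Real.exp (b * r) * ‖fourierMeasure ν h r‖) (Set.Ioi 0))
    (p : ℕ) {s : ℝ} (hs : 0 ≤ s) :
    ‖fourierMeasure ν (fun x => h x * halfLineTransform a x ^ (p + 1)) s‖ ≤
      σ * (∫ r in Set.Ioi 0, Real.exp (b * r) * ‖fourierMeasure ν h r‖) * (σ / b) ^ p *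
        Real.exp (-b * s) := by
  induction p generalizing s with
  | zero =>
    simpa using norm_fourierMeasure_mul_halfLineTransform_le_of_integrableOn hh ha hσ hb.le hT hs
  | succ p ih =>
    have hint := integrable_mul_pow_of_norm_le hh
      (continuous_fourierMeasure ha).aestronglyMeasurable (norm_fourierMeasure_le _ a) (p + 1)
    have hstep := norm_fourierMeasure_mul_halfLineTransform_le_of_norm_le hint ha hσ hb
      (fun r hr => ih hr) hs
    simpa only [pow_succ _ (p + 1), pow_succ _ p, mul_assoc] using hstep

theorem norm_integral_mul_exp_halfLineTransform_sub_le (hh : Integrable h ν)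
    (ha : IntegrableOn a (Set.Ioi 0)) (hσ : ∀ t > 0, ‖a t‖ ≤ σ) (hb : 0 < b)
    (hT : IntegrableOn (fun r => Real.exp (b * r) * ‖fourierMeasure ν h r‖) (Set.Ioi 0)) (z : ℂ) :
    ‖∫ x, h x * Complex.exp (z * halfLineTransform a x) ∂ν - ∫ x, h x ∂ν‖ ≤
      σ * (∫ r in Set.Ioi 0, Real.exp (b * r) * ‖fourierMeasure ν h r‖) * ‖z‖ *
        Real.exp (‖z‖ * (σ / b)) := by
  refine norm_integral_mul_exp_sub_le hh (continuous_fourierMeasure ha).aestronglyMeasurable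
    (norm_fourierMeasure_le _ a) (fun p => ?_) z
  simpa [fourierMeasure] using
    norm_fourierMeasure_mul_halfLineTransform_pow_le hh ha hσ hb hT p le_rfl

end HalfLine

/-! ### Cauchy integrals and compact null sets -/

section CauchyIntegral

/-- The Cauchy integral `∫ dμ(c) / (δ + i (x - c))` of `μ` on the line at height `δ`, normalized so
that its real part is `π` times the Poisson integral of `μ`. -/
noncomputable def cauchyIntegral (δ : ℝ) (μ : Measure ℝ) (x : ℝ) : ℂ :=
  ∫ c, ((δ : ℂ) + Complex.I * ((x - c : ℝ) : ℂ))⁻¹ ∂μ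

/-- The function on the half-line `(0, ∞)` whose half-line transform is `cauchyIntegral δ μ`. -/
noncomputable def cauchyDensity (δ : ℝ) (μ : Measure ℝ) (s : ℝ) : ℂ :=
  (Real.exp (-δ * s) : ℂ) * fourierMeasure μ 1 (-s)

theorem halfLineTransform_exp {δ : ℝ} (hδ : 0 < δ) (y : ℝ) :
    halfLineTransform (fun s => (Real.exp (-δ * s) : ℂ)) y = ((δ : ℂ) + Complex.I * y)⁻¹ := by
  have hexp := integral_exp_mul_complex_Ioi (a := -((δ : ℂ) + Complex.I * y)) (by simpa using hδ) 0
  simp only [Complex.ofReal_zero, mul_zero, Complex.exp_zero, neg_div_neg_eq, one_div] at hexp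
  rw [← hexp]
  refine integral_congr_ae (Eventually.of_forall fun s => ?_)
  simp only [Complex.ofReal_exp, ← Complex.exp_add]
  congr 1
  push_cast
  ring

theorem fourierMeasure_map_neg (μ : Measure ℝ) (f : ℝ → ℂ) (k : ℝ) :
    fourierMeasure (μ.map Neg.neg) f k = fourierMeasure μ (fun x => f (-x)) (-k) := by
  rw [fourierMeasure, measurableEmbedding_neg.integral_map]
  simp [fourierMeasure]

theorem re_cauchyKernel (δ y : ℝ) :
    (((δ : ℂ) + Complex.I * y)⁻¹).re = δ / (δ ^ 2 + y ^ 2) := by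
  rw [Complex.inv_re, Complex.normSq_apply]
  simp [sq]

theorem norm_cauchyKernel_le (δ : ℝ) {y : ℝ} (hy : y ≠ 0) :
    ‖((δ : ℂ) + Complex.I * y)⁻¹‖ ≤ |y|⁻¹ := by
  rw [norm_inv]
  refine inv_anti₀ (abs_pos.2 hy) ?_
  simpa using Complex.abs_im_le_norm ((δ : ℂ) + Complex.I * y)

variable {δ : ℝ} {μ : Measure ℝ} [IsFiniteMeasure μ]

theorem norm_cauchyDensity_le (δ : ℝ) (μ : Measure ℝ) (s : ℝ) :
    ‖cauchyDensity δ μ s‖ ≤ Real.exp (-δ * s) * μ.real Set.univ := by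
  rw [cauchyDensity, norm_mul, Complex.norm_real, Real.norm_of_nonneg (Real.exp_nonneg _)]
  gcongr
  simpa using norm_fourierMeasure_le μ 1 (-s)

theorem integrableOn_exp_neg_mul_ofReal (hδ : 0 < δ) :
    IntegrableOn (fun s : ℝ => (Real.exp (-δ * s) : ℂ)) (Set.Ioi 0) :=
  (exp_neg_integrableOn_Ioi 0 hδ).ofReal

theorem integrableOn_cauchyDensity (hδ : 0 < δ) : IntegrableOn (cauchyDensity δ μ) (Set.Ioi 0) :=
  (integrableOn_exp_neg_mul_ofReal hδ).mul_bdd (c := μ.real Set.univ)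
    ((continuous_fourierMeasure (integrable_const 1)).comp continuous_neg).aestronglyMeasurable
    (Eventually.of_forall fun s => by simpa using norm_fourierMeasure_le μ 1 (-s))

theorem halfLineTransform_cauchyDensity (hδ : 0 < δ) :
    halfLineTransform (cauchyDensity δ μ) = cauchyIntegral δ μ := by
  funext x
  calc halfLineTransform (cauchyDensity δ μ) x
      = ∫ s in Set.Ioi 0, fourierMeasure (μ.map Neg.neg) 1 s *
          ((Real.exp (-δ * s) : ℂ) * Complex.exp (-(Complex.I * x * s))) := by
        refine integral_congr_ae (Eventually.of_forall fun s => ?_)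
        simp only [cauchyDensity, fourierMeasure_map_neg, Pi.one_def]
        ring
    _ = ∫ c, halfLineTransform (fun s => (Real.exp (-δ * s) : ℂ)) (x + c) ∂μ.map Neg.neg := by
        rw [integral_fourierMeasure_mul (f := 1) (integrable_const 1)
          (integrable_mul_cexp (integrableOn_exp_neg_mul_ofReal hδ) x)]
        simp only [Pi.one_apply, one_mul, fourierMeasure_mul_cexp]
    _ = cauchyIntegral δ μ x := by
        rw [measurableEmbedding_neg.integral_map]
        simp only [halfLineTransform_exp hδ, cauchyIntegral, sub_eq_add_neg]

theorem integrable_cauchyKernel (hδ : 0 < δ) (x : ℝ) :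
    Integrable (fun c : ℝ => ((δ : ℂ) + Complex.I * ((x - c : ℝ) : ℂ))⁻¹) μ := by
  have hre (c : ℝ) : δ ≤ ‖(δ : ℂ) + Complex.I * ((x - c : ℝ) : ℂ)‖ := by
    simpa using Complex.re_le_norm ((δ : ℂ) + Complex.I * ((x - c : ℝ) : ℂ))
  refine Integrable.of_bound (C := δ⁻¹) ?_ (Eventually.of_forall fun c => ?_)
  · exact (Continuous.inv₀ (by fun_prop) fun c =>
      norm_pos_iff.1 (hδ.trans_le (hre c))).aestronglyMeasurable
  · rw [norm_inv]
    exact inv_anti₀ hδ (hre c)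

theorem re_cauchyIntegral (hδ : 0 < δ) (x : ℝ) :
    (cauchyIntegral δ μ x).re = ∫ c, δ / (δ ^ 2 + (x - c) ^ 2) ∂μ := by
  have hre := integral_re (integrable_cauchyKernel (μ := μ) hδ x)
  simp only [RCLike.re_to_complex, re_cauchyKernel] at hre
  exact hre.symm

theorem re_cauchyIntegral_nonneg (hδ : 0 < δ) (x : ℝ) : 0 ≤ (cauchyIntegral δ μ x).re := by
  rw [re_cauchyIntegral hδ]
  exact integral_nonneg fun c => by positivity

theorem norm_cauchyIntegral_le {x r : ℝ} (hr : 0 < r) (h : ∀ᵐ c ∂μ, r ≤ |x - c|) :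
    ‖cauchyIntegral δ μ x‖ ≤ r⁻¹ * μ.real Set.univ := by
  refine norm_integral_le_of_norm_le_const (h.mono fun c hc => ?_)
  exact (norm_cauchyKernel_le δ (abs_pos.1 (hr.trans_le hc))).trans (inv_anti₀ hr hc)

theorem one_le_re_cauchyIntegral (hδ : 0 < δ) {U : Set ℝ} [IsFiniteMeasure (volume.restrict U)]
    {x : ℝ} (hx : Set.Icc (x - δ) (x + δ) ⊆ U) :
    1 ≤ (cauchyIntegral δ (volume.restrict U) x).re := by
  rw [re_cauchyIntegral hδ]
  have hint : IntegrableOn (fun c : ℝ => δ / (δ ^ 2 + (x - c) ^ 2)) U := by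
    refine (integrable_cauchyKernel hδ x).re.congr (Eventually.of_forall fun c => ?_)
    simp only [RCLike.re_to_complex, re_cauchyKernel]
  calc (1 : ℝ) = ∫ _ in Set.Icc (x - δ) (x + δ), 1 / (2 * δ) := by
        simp only [integral_const, MeasurableSet.univ, measureReal_restrict_apply, Set.univ_inter,
          Real.volume_real_Icc, smul_eq_mul]
        rw [max_eq_left (by linarith)]
        field_simp
        ring
    _ ≤ ∫ c in Set.Icc (x - δ) (x + δ), δ / (δ ^ 2 + (x - c) ^ 2) := by
        refine setIntegral_mono_on (integrable_const _) (hint.mono_set hx) measurableSet_Icc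
          fun c hc => ?_
        have hsq : (x - c) ^ 2 ≤ δ ^ 2 := sq_le_sq' (by linarith [hc.2]) (by linarith [hc.1])
        rw [div_le_div_iff₀ (by positivity) (by positivity)]
        nlinarith
    _ ≤ ∫ c in U, δ / (δ ^ 2 + (x - c) ^ 2) :=
        setIntegral_mono_set hint (Eventually.of_forall fun c => by positivity) hx.eventuallyLE

theorem tendsto_cauchyIntegral_cthickening {δ : ℕ → ℝ} (hδ : ∀ n, 0 ≤ δ n)
    (hδ0 : Tendsto δ atTop (𝓝 0)) {K : Set ℝ} (hK : IsCompact K)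
    (hvol : Tendsto (fun n => volume.real (Metric.cthickening (δ n) K)) atTop (𝓝 0))
    {x : ℝ} (hx : x ∉ K) :
    Tendsto (fun n => cauchyIntegral (δ n) (volume.restrict (Metric.cthickening (δ n) K)) x)
      atTop (𝓝 0) := by
  rcases K.eq_empty_or_nonempty with rfl | hne
  · simp [cauchyIntegral]
  have hd : 0 < Metric.infDist x K := (hK.isClosed.notMem_iff_infDist_pos hne).1 hx
  refine squeeze_zero_norm' ?_ (by simpa using hvol.const_mul (Metric.infDist x K / 2)⁻¹)
  filter_upwards [hδ0.eventually (gt_mem_nhds (half_pos hd))] with n hn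
  have : IsFiniteMeasure (volume.restrict (Metric.cthickening (δ n) K)) :=
    isFiniteMeasure_restrict.2 hK.cthickening.measure_ne_top
  have hdist : ∀ c ∈ Metric.cthickening (δ n) K, Metric.infDist x K / 2 ≤ |x - c| := by
    intro c hc
    have hcK : Metric.infDist c K ≤ δ n :=
      ENNReal.toReal_le_of_le_ofReal (hδ n) (Metric.mem_cthickening_iff.1 hc)
    have hxc := Metric.infDist_le_infDist_add_dist (s := K) (x := x) (y := c)
    rw [Real.dist_eq] at hxc
    linarith
  simpa using norm_cauchyIntegral_le (half_pos hd)
    (ae_restrict_of_forall_mem Metric.isClosed_cthickening.measurableSet hdist)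

end CauchyIntegral

section CompactNullSets

variable {α : Type*} [MeasurableSpace α] {ν : Measure α} {h : α → ℂ} {K : Set α}

theorem tendsto_setIntegral_mul_of_tendsto_one_compl (hh : Integrable h ν) (hK : MeasurableSet K)
    {E : ℕ → α → ℂ} (hE : ∀ n, AEStronglyMeasurable (E n) ν) (hE1 : ∀ n x, ‖E n x‖ ≤ 1)
    (hlim : ∀ x ∉ K, Tendsto (fun n => E n x) atTop (𝓝 1))
    (hint : Tendsto (fun n => ∫ x, h x * E n x ∂ν) atTop (𝓝 (∫ x, h x ∂ν))) :
    Tendsto (fun n => ∫ x in K, h x * E n x ∂ν) atTop (𝓝 (∫ x in K, h x ∂ν)) := by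
  have hhE (n : ℕ) : Integrable (fun x => h x * E n x) ν :=
    hh.mul_bdd (hE n) (Eventually.of_forall (hE1 n))
  have hcompl : Tendsto (fun n => ∫ x in Kᶜ, h x * E n x ∂ν) atTop (𝓝 (∫ x in Kᶜ, h x ∂ν)) := by
    refine tendsto_integral_of_dominated_convergence (fun x => ‖h x‖) (fun n => (hhE n).1.restrict)
      hh.norm.integrableOn (fun n => Eventually.of_forall fun x => ?_)
      (ae_restrict_of_forall_mem hK.compl fun x hx => by simpa using (hlim x hx).const_mul (h x))
    rw [norm_mul]
    exact mul_le_of_le_one_right (norm_nonneg _) (hE1 n x)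
  have hsub := hint.sub hcompl
  rw [← integral_add_compl hK hh, add_sub_cancel_right] at hsub
  refine hsub.congr fun n => ?_
  rw [← integral_add_compl hK (hhE n), add_sub_cancel_right]

theorem setIntegral_eq_zero_of_tendsto_integral_mul_exp (hh : Integrable h ν)
    (hK : MeasurableSet K) {G : ℕ → α → ℂ} (hG : ∀ n, AEMeasurable (G n) ν)
    (hre : ∀ n x, 0 ≤ (G n x).re) (hreK : ∀ n, ∀ x ∈ K, 1 ≤ (G n x).re)
    (hG0 : ∀ x ∉ K, Tendsto (fun n => G n x) atTop (𝓝 0))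
    (hint : ∀ N : ℕ, Tendsto (fun n => ∫ x, h x * Complex.exp (-N * G n x) ∂ν) atTop
      (𝓝 (∫ x, h x ∂ν))) :
    ∫ x in K, h x ∂ν = 0 := by
  have hnorm (N n : ℕ) (x : α) : ‖Complex.exp (-N * G n x)‖ = Real.exp (-N * (G n x).re) := by
    simp [Complex.norm_exp]
  have hsetIntegral (N : ℕ) : Tendsto (fun n => ∫ x in K, h x * Complex.exp (-N * G n x) ∂ν) atTop
      (𝓝 (∫ x in K, h x ∂ν)) := by
    refine tendsto_setIntegral_mul_of_tendsto_one_compl hh hK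
      (fun n => ((hG n).const_mul _).cexp.aestronglyMeasurable) (fun n x => ?_)
      (fun x hx => ?_) (hint N)
    · rw [hnorm, Real.exp_le_one_iff]
      nlinarith [hre n x, N.cast_nonneg (α := ℝ)]
    · simpa using ((hG0 x hx).const_mul (-N : ℂ)).cexp
  have hbound (N : ℕ) : ‖∫ x in K, h x ∂ν‖ ≤ Real.exp (-N) * ∫ x in K, ‖h x‖ ∂ν := by
    refine le_of_tendsto (hsetIntegral N).norm (Eventually.of_forall fun n => ?_)
    rw [← integral_const_mul]
    refine norm_integral_le_of_norm_le (hh.norm.const_mul _).integrableOn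
      (ae_restrict_of_forall_mem hK fun x hx => ?_)
    rw [norm_mul, hnorm, mul_comm]
    gcongr
    nlinarith [hreK n x hx, N.cast_nonneg (α := ℝ)]
  have hexp : Tendsto (fun N : ℕ => Real.exp (-(N : ℝ))) atTop (𝓝 0) :=
    Real.tendsto_exp_neg_atTop_nhds_zero.comp tendsto_natCast_atTop_atTop
  exact norm_le_zero_iff.1
    (ge_of_tendsto' (by simpa using hexp.mul_const (∫ x in K, ‖h x‖ ∂ν)) hbound)

end CompactNullSets

section ExponentialDecay

variable {ν : Measure ℝ} [IsFiniteMeasure ν] {h : ℝ → ℂ} {b : ℝ}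

/- The Cauchy integrals of shrinking neighbourhoods of `K` have total mass tending to `0`, so that
`exp (-N G)` becomes invisible to `h dν` globally, while it is at most `exp (-N)` on `K`. -/
theorem setIntegral_eq_zero_of_integrableOn_exp_mul_fourierMeasure (hh : Integrable h ν)
    (hb : 0 < b)
    (hT : IntegrableOn (fun r => Real.exp (b * r) * ‖fourierMeasure ν h r‖) (Set.Ioi 0))
    {K : Set ℝ} (hK : IsCompact K) (hK0 : volume K = 0) : ∫ x in K, h x ∂ν = 0 := by
  set δ : ℕ → ℝ := fun n => 1 / ((n : ℝ) + 1)
  have hδ (n : ℕ) : 0 < δ n := by positivity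
  have hδ0 : Tendsto δ atTop (𝓝 0) := tendsto_one_div_add_atTop_nhds_zero_nat
  set μ : ℕ → Measure ℝ := fun n => volume.restrict (Metric.cthickening (δ n) K)
  have hμ (n : ℕ) : IsFiniteMeasure (μ n) :=
    isFiniteMeasure_restrict.2 hK.cthickening.measure_ne_top
  have hvol : Tendsto (fun n => volume.real (Metric.cthickening (δ n) K)) atTop (𝓝 0) := by
    have hmeasure := (tendsto_measure_cthickening_of_isCompact (μ := volume) hK).comp hδ0
    rw [hK0] at hmeasure
    exact (ENNReal.tendsto_toReal ENNReal.zero_ne_top).comp hmeasure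
  have hcont (n : ℕ) : Continuous (cauchyIntegral (δ n) (μ n)) := by
    rw [← halfLineTransform_cauchyDensity (hδ n)]
    exact continuous_fourierMeasure (integrableOn_cauchyDensity (hδ n))
  refine setIntegral_eq_zero_of_tendsto_integral_mul_exp hh hK.measurableSet
    (G := fun n => cauchyIntegral (δ n) (μ n)) (fun n => (hcont n).measurable.aemeasurable)
    (fun n => re_cauchyIntegral_nonneg (hδ n)) (fun n x hx => ?_)
    (fun x hx => tendsto_cauchyIntegral_cthickening (fun n => (hδ n).le) hδ0 hK hvol hx)
    fun N => ?_
  · refine one_le_re_cauchyIntegral (hδ n) ?_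
    rw [← Real.closedBall_eq_Icc]
    exact Metric.closedBall_subset_cthickening hx _
  · have hdensity (n : ℕ) (t : ℝ) (ht : 0 < t) :
        ‖cauchyDensity (δ n) (μ n) t‖ ≤ volume.real (Metric.cthickening (δ n) K) := by
      refine (norm_cauchyDensity_le _ _ t).trans ?_
      rw [measureReal_restrict_apply_univ]
      exact mul_le_of_le_one_left measureReal_nonneg
        (Real.exp_le_one_iff.2 (by nlinarith [hδ n]))
    rw [tendsto_iff_norm_sub_tendsto_zero]
    refine squeeze_zero (fun n => norm_nonneg _) (fun n => ?_)
      (g := fun n => volume.real (Metric.cthickening (δ n) K) *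
        (∫ r in Set.Ioi 0, Real.exp (b * r) * ‖fourierMeasure ν h r‖) * ‖(-N : ℂ)‖ *
        Real.exp (‖(-N : ℂ)‖ * (volume.real (Metric.cthickening (δ n) K) / b))) ?_
    · rw [← halfLineTransform_cauchyDensity (hδ n)]
      exact norm_integral_mul_exp_halfLineTransform_sub_le hh (integrableOn_cauchyDensity (hδ n))
        (hdensity n) hb hT (-N)
    · simpa using ((hvol.mul_const _).mul_const ‖(-N : ℂ)‖).mul
        ((hvol.div_const b).const_mul ‖(-N : ℂ)‖).rexp

theorem exists_integrable_density_of_integrableOn_exp_mul_fourierMeasure (hh : Integrable h ν)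
    (hb : 0 < b)
    (hT : IntegrableOn (fun r => Real.exp (b * r) * ‖fourierMeasure ν h r‖) (Set.Ioi 0)) :
    ∃ m : ℝ → ℂ, Integrable m ∧ ∫ x, ‖m x‖ ≤ ∫ x, ‖h x‖ ∂ν ∧
      ∀ g : ℝ → ℂ, Integrable (fun x => g x * h x) ν →
        ∫ x, g x * h x ∂ν = ∫ x, g x * m x :=
  exists_integrable_density_of_forall_setIntegral hh fun _ hB hB0 =>
    setIntegral_eq_zero_of_forall_isCompact hh hB fun _ hKB hK =>
      setIntegral_eq_zero_of_integrableOn_exp_mul_fourierMeasure hh hb hT hK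
        (measure_mono_null hKB hB0)

end ExponentialDecay

/-! ### The effective domain -/

theorem integrable_exp_neg_mul_abs {c : ℝ} (hc : 0 < c) :
    Integrable fun x : ℝ => Real.exp (-c * |x|) := by
  rw [← integrableOn_univ, ← Set.Iic_union_Ioi (a := (0 : ℝ))]
  refine IntegrableOn.union ?_ ?_
  · refine (integrableOn_exp_mul_Iic hc 0).congr_fun (fun x hx => ?_) measurableSet_Iic
    simp [abs_of_nonpos (Set.mem_Iic.1 hx)]
  · refine (exp_neg_integrableOn_Ioi 0 hc).congr_fun (fun x hx => ?_) measurableSet_Ioi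
    simp [abs_of_pos (Set.mem_Ioi.1 hx)]

theorem integrable_ofReal_exp_neg_abs : Integrable fun x : ℝ => (Real.exp (-|x|) : ℂ) := by
  simpa using (integrable_exp_neg_mul_abs one_pos).ofReal (𝕜 := ℂ)

theorem fourier_exp_neg_abs (k : ℝ) :
    fourier (fun x => (Real.exp (-|x|) : ℂ)) k = 2 / (1 + (k : ℂ) ^ 2) := by
  have hneg : (1 - Complex.I * k) ≠ 0 := fun h => by simpa using congrArg Complex.re h
  have hpos : (1 + Complex.I * k) ≠ 0 := fun h => by simpa using congrArg Complex.re h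
  have hint := integrable_mul_cexp integrable_ofReal_exp_neg_abs k
  have hIic : ∫ x in Set.Iic (0 : ℝ), (Real.exp (-|x|) : ℂ) *
      Complex.exp (-(Complex.I * k * x)) = (1 - Complex.I * k)⁻¹ := by
    have htransform := halfLineTransform_exp one_pos (-k)
    rw [halfLineTransform, fourierMeasure, ← neg_zero, ← integral_comp_neg_Iic] at htransform
    simp only [Complex.ofReal_one, Complex.ofReal_neg, mul_neg, ← sub_eq_add_neg] at htransform
    rw [← htransform]
    refine setIntegral_congr_fun measurableSet_Iic fun x hx => ?_
    simp [abs_of_nonpos (Set.mem_Iic.1 hx)]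
  have hIoi : ∫ x in Set.Ioi (0 : ℝ), (Real.exp (-|x|) : ℂ) *
      Complex.exp (-(Complex.I * k * x)) = (1 + Complex.I * k)⁻¹ := by
    rw [← Complex.ofReal_one, ← halfLineTransform_exp one_pos k]
    refine setIntegral_congr_fun measurableSet_Ioi fun x hx => ?_
    simp [abs_of_pos (Set.mem_Ioi.1 hx)]
  have hfactor : (1 + (k : ℂ) ^ 2) = (1 + Complex.I * k) * (1 - Complex.I * k) := by
    linear_combination (k : ℂ) ^ 2 * Complex.I_sq
  rw [fourier, ← intervalIntegral.integral_Iic_add_Ioi hint.integrableOn hint.integrableOn, hIic,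
    hIoi, hfactor]
  field_simp
  ring

theorem integrable_fourier_exp_neg_abs :
    Integrable (fourier fun x => (Real.exp (-|x|) : ℂ)) := by
  refine ((integrable_inv_one_add_sq.const_mul 2).ofReal (𝕜 := ℂ)).congr
    (Eventually.of_forall fun k => ?_)
  simp only [fourier_exp_neg_abs, div_eq_mul_inv]
  push_cast
  rfl

theorem exists_L1_fourier_eq {f : ℝ → ℂ} (hfc : Continuous f) (hf : Integrable f)
    (hff : Integrable (fourier f)) : ∃ m : L1, fourier m = f := by
  have hm : Integrable fun x => (2 * Real.pi : ℂ)⁻¹ * fourier f (-x) := hff.comp_neg.const_mul _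
  exact ⟨hm.toL1, (fourier_congr_ae hm.coeFn_toL1).trans (funext (fourier_inversion hfc hf hff))⟩

theorem memL2_exp_neg_abs_sub_expFun {γ : ℝ} (hγ : 2 < γ) :
    MemL2 γ fun k => (Real.exp (-|k|) : ℂ) - expFun k := by
  have hcont : Continuous fun k => (Real.exp (-γ * k / 2) : ℂ) *
      ((Real.exp (-|k|) : ℂ) - expFun k) := by
    unfold expFun
    fun_prop
  rw [memL2_iff_memLp_exp_mul, memLp_two_iff_integrable_sq_norm hcont.aestronglyMeasurable]
  refine (integrable_exp_neg_mul_abs (c := γ - 2) (by linarith)).mono'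
    (hcont.norm.pow 2).aestronglyMeasurable (Eventually.of_forall fun k => ?_)
  simp only [expFun, norm_pow, norm_mul, Complex.norm_real, Real.norm_eq_abs,
    Real.abs_exp, ← Complex.ofReal_sub, abs_abs]
  rcases le_or_gt k 0 with hk | hk
  · simp [abs_of_nonpos hk, Real.exp_nonneg]
  · have hdiff : |Real.exp (-|k|) - Real.exp k| ≤ Real.exp k := by
      rw [abs_of_pos hk, abs_le]
      have hle : Real.exp (-k) ≤ Real.exp k := Real.exp_le_exp.2 (by linarith)
      constructor <;> linarith [Real.exp_pos k, Real.exp_pos (-k)]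
    calc (Real.exp (-γ * k / 2) * |Real.exp (-|k|) - Real.exp k|) ^ 2
        ≤ (Real.exp (-γ * k / 2) * Real.exp k) ^ 2 := by gcongr
      _ = Real.exp (-(γ - 2) * |k|) := by
        rw [← Real.exp_add, ← Real.exp_nat_mul, abs_of_pos hk]
        congr 1
        push_cast
        ring

theorem primalDomain_nonempty {γ : ℝ} (hγ : 2 < γ) : (primalDomain γ).Nonempty := by
  obtain ⟨m, hm⟩ := exists_L1_fourier_eq (by fun_prop) integrable_ofReal_exp_neg_abs
    integrable_fourier_exp_neg_abs
  refine ⟨m, ?_⟩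
  rw [primalDomain, Set.mem_ofPred_eq, hm]
  exact memL2_exp_neg_abs_sub_expFun hγ

theorem ne_zero_of_mem_primalDomain {γ : ℝ} (hγ : 2 < γ) {m : L1} (hm : m ∈ primalDomain γ) :
    m ≠ 0 := by
  rintro rfl
  have hfourier : fourier ((0 : L1) : ℝ → ℂ) = 0 := by
    rw [fourier_congr_ae (Lp.coeFn_zero ℂ 1 volume)]
    funext k
    simp [fourier]
  rw [primalDomain, Set.mem_ofPred_eq, hfourier, memL2_iff_memLp_exp_mul] at hm
  have hsq := (memLp_two_iff_integrable_sq_norm hm.1).1 hm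
  have hone : IntegrableOn (fun _ : ℝ => (1 : ℝ)) (Set.Iic 0) := by
    refine (hsq.integrableOn (s := Set.Iic 0)).mono' (by fun_prop) ?_
    refine ae_restrict_of_forall_mem measurableSet_Iic fun k (hk : k ≤ 0) => ?_
    simp only [Pi.zero_apply, zero_sub, norm_mul, norm_neg, expFun, Complex.norm_real,
      Real.norm_eq_abs, Real.abs_exp, ← Real.exp_add, ← Real.exp_nat_mul, abs_one]
    rw [Real.one_le_exp_iff]
    push_cast
    nlinarith
  simp [integrableOn_const_iff] at hone

/-! ### The pairing of the exponential with a Fourier transform -/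

section Pairing

variable {γ ε : ℝ} {g : C₀(ℝ, ℂ)} {u φ : ℝ → ℂ}

theorem IsTestFunction.exists_bound (hφ : IsTestFunction φ) : ∃ C, ∀ x, ‖φ x‖ ≤ C :=
  hφ.continuous.bounded_above_of_compact_support hφ.2

theorem IsTestFunction.memL2 (hφ : IsTestFunction φ) (γ : ℝ) : MemL2 γ φ := by
  rw [memL2_iff_memLp_exp_mul]
  have hcont := hφ.continuous
  exact Continuous.memLp_of_hasCompactSupport (by fun_prop) hφ.2.mul_left

theorem IsTestFunction.comp_mul_mul_cexp (hφ : IsTestFunction φ) (hε : ε ≠ 0) (y : ℝ) :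
    IsTestFunction fun k : ℝ => φ (ε * k) * Complex.exp (-(Complex.I * y * k)) := by
  refine ⟨?_, ?_⟩
  · exact (hφ.1.comp (contDiff_const.mul contDiff_id)).mul
      (ContDiff.cexp (contDiff_const.mul Complex.ofRealCLM.contDiff).neg)
  · exact HasCompactSupport.mul_right (hφ.2.comp_homeomorph (Homeomorph.mulLeft₀ ε hε))

theorem fourier_comp_mul_mul_cexp (φ : ℝ → ℂ) (hε : 0 < ε) (y x : ℝ) :
    fourier (fun k : ℝ => φ (ε * k) * Complex.exp (-(Complex.I * y * k))) x =
      (ε⁻¹ : ℝ) • fourier φ (ε⁻¹ * (x + y)) := by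
  have hscale := Measure.integral_comp_mul_left
    (fun k : ℝ => φ k * Complex.exp (-(Complex.I * ((ε⁻¹ * (x + y) : ℝ) : ℂ) * k))) ε
  rw [abs_of_pos (by positivity)] at hscale
  rw [fourier, fourier, ← hscale]
  refine integral_congr_ae (Eventually.of_forall fun k => ?_)
  have hε0 : (ε : ℂ) ≠ 0 := by exact_mod_cast hε.ne'
  simp only [mul_assoc, ← Complex.exp_add]
  congr 2
  push_cast
  field_simp
  ring

theorem IsDualAdmissible.integrable_comp_mul_mul (hu : IsDualAdmissible γ g u)
    (hφ : IsTestFunction φ) (hε : ε ≠ 0) : Integrable fun k => φ (ε * k) * u k :=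
  hu.1.1.integrable_smul_left_of_hasCompactSupport (hφ.continuous.comp (continuous_const_mul ε))
    (hφ.2.comp_homeomorph (Homeomorph.mulLeft₀ ε hε))

theorem IsDualAdmissible.fourier_comp_mul_mul (hu : IsDualAdmissible γ g u)
    (hφ : IsTestFunction φ) (hε : 0 < ε) (y : ℝ) :
    fourier (fun k => φ (ε * k) * u k) y = ∫ t, g (ε * t - y) * fourier φ t := by
  have hscale := Measure.integral_comp_mul_left
    (fun x : ℝ => g (x - y) * fourier φ (ε⁻¹ * x)) ε
  rw [abs_of_pos (by positivity)] at hscale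
  calc fourier (fun k => φ (ε * k) * u k) y
      = ∫ k, u k * (φ (ε * k) * Complex.exp (-(Complex.I * y * k))) := by
        refine integral_congr_ae (Eventually.of_forall fun k => ?_)
        simp only
        ring
    _ = ∫ x, g x * ((ε⁻¹ : ℝ) • fourier φ (ε⁻¹ * (x + y))) := by
        rw [hu.1.2 _ (hφ.comp_mul_mul_cexp hε.ne' y)]
        simp_rw [fourier_comp_mul_mul_cexp φ hε y]
    _ = ∫ x, g (x - y) * ((ε⁻¹ : ℝ) • fourier φ (ε⁻¹ * x)) := by
        rw [← integral_add_right_eq_self (μ := volume)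
          (fun x : ℝ => g (x - y) * ((ε⁻¹ : ℝ) • fourier φ (ε⁻¹ * x))) y]
        simp only [add_sub_cancel_right]
    _ = ε⁻¹ • ∫ x, g (x - y) * fourier φ (ε⁻¹ * x) := by
        simp only [mul_smul_comm, integral_smul]
    _ = ∫ t, g (ε * t - y) * fourier φ t := by
        rw [← hscale]
        simp only [inv_mul_cancel_left₀ hε.ne']

theorem tendsto_integral_comp_mul_mul {f w : ℝ → ℂ} (hf : Continuous f) {C : ℝ}
    (hC : ∀ x, ‖f x‖ ≤ C) {μ : Measure ℝ} (hw : Integrable w μ) :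
    Tendsto (fun ε : ℝ => ∫ t, f (ε * t) * w t ∂μ) (𝓝 0) (𝓝 (f 0 * ∫ t, w t ∂μ)) := by
  rw [← integral_const_mul]
  refine tendsto_integral_filter_of_dominated_convergence (fun t => C * ‖w t‖)
    (Eventually.of_forall fun ε => ?_)
    (Eventually.of_forall fun ε => Eventually.of_forall fun t => ?_) (hw.norm.const_mul C)
    (Eventually.of_forall fun t => ?_)
  · exact (hf.comp (continuous_const_mul ε)).aestronglyMeasurable.mul hw.1
  · rw [norm_mul]
    gcongr
    exact hC _
  · have hcont : Continuous fun ε : ℝ => f (ε * t) := hf.comp (continuous_mul_const t)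
    simpa using (hcont.tendsto 0).mul_const (w t)

theorem IsDualAdmissible.norm_fourier_comp_mul_mul_le (hu : IsDualAdmissible γ g u)
    (hφ : IsTestFunction φ) (hε : 0 < ε) (y : ℝ) :
    ‖fourier (fun k => φ (ε * k) * u k) y‖ ≤ ‖g‖ * ∫ t, ‖fourier φ t‖ := by
  rw [hu.fourier_comp_mul_mul hφ hε, ← integral_const_mul]
  refine norm_integral_le_of_norm_le (hφ.integrable_fourier.norm.const_mul _)
    (Eventually.of_forall fun t => ?_)
  rw [norm_mul]
  gcongr
  exact norm_zeroAtInfty_apply_le g _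

theorem IsDualAdmissible.tendsto_fourier_comp_mul_mul (hu : IsDualAdmissible γ g u)
    (hφ : IsTestFunction φ) (y : ℝ) :
    Tendsto (fun ε : ℝ => fourier (fun k => φ (ε * k) * u k) y) (𝓝[>] 0)
      (𝓝 (2 * Real.pi * φ 0 * g (-y))) := by
  have hlim := tendsto_integral_comp_mul_mul (f := fun s => g (s - y))
    ((map_continuous g).comp (continuous_sub_right y)) (fun s => norm_zeroAtInfty_apply_le g _)
    hφ.integrable_fourier
  rw [zero_sub, integral_fourier hφ.continuous hφ.integrable hφ.integrable_fourier,
    mul_comm] at hlim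
  refine (hlim.mono_left nhdsWithin_le_nhds).congr' ?_
  filter_upwards [self_mem_nhdsWithin] with ε hε
  exact (hu.fourier_comp_mul_mul hφ hε y).symm

theorem IsDualAdmissible.tendsto_integral_comp_mul_mul_fourier {m : ℝ → ℂ}
    (hu : IsDualAdmissible γ g u) (hφ : IsTestFunction φ) (hm : Integrable m) :
    Tendsto (fun ε : ℝ => ∫ k, φ (ε * k) * u k * fourier m k) (𝓝[>] 0)
      (𝓝 (2 * Real.pi * φ 0 * ∫ y, m y * g (-y))) := by
  have hlim : Tendsto (fun ε : ℝ => ∫ y, m y * fourier (fun k => φ (ε * k) * u k) y) (𝓝[>] 0)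
      (𝓝 (∫ y, m y * (2 * Real.pi * φ 0 * g (-y)))) := by
    refine tendsto_integral_filter_of_dominated_convergence
      (fun y => ‖m y‖ * (‖g‖ * ∫ t, ‖fourier φ t‖)) ?_ ?_ (hm.norm.mul_const _)
      (Eventually.of_forall fun y => (hu.tendsto_fourier_comp_mul_mul hφ y).const_mul _)
    · filter_upwards [self_mem_nhdsWithin] with ε hε
      exact hm.1.mul (continuous_fourier
        (hu.integrable_comp_mul_mul hφ (ne_of_gt hε))).aestronglyMeasurable
    · filter_upwards [self_mem_nhdsWithin] with ε hε
      refine Eventually.of_forall fun y => ?_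
      rw [norm_mul]
      gcongr
      exact hu.norm_fourier_comp_mul_mul_le hφ hε y
  simp only [mul_left_comm (_ : ℂ) (2 * Real.pi * φ 0), integral_const_mul] at hlim
  refine hlim.congr' ?_
  filter_upwards [self_mem_nhdsWithin] with ε hε
  rw [← integral_fourier_mul hm (hu.integrable_comp_mul_mul hφ (ne_of_gt hε))]
  simp only [mul_comm (fourier m _)]

/-- The value of `⟨exp, ĝ⟩` (with `u = ĝ`), computed with the help of an element `m` of the
effective domain: `exp = m̂ - (m̂ - exp)`, where `m̂` pairs with `ĝ` by Parseval's formula and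
`m̂ - exp` by the duality between `L²_γ` and `L²_{-γ}`. -/
noncomputable def expPairing (m : ℝ → ℂ) (g : C₀(ℝ, ℂ)) (u : ℝ → ℂ) : ℂ :=
  2 * Real.pi * (∫ y, m y * g (-y)) - ∫ k, u k * (fourier m k - expFun k)

theorem integrable_mul_fourier {m f : ℝ → ℂ} (hm : Integrable m) (hf : Integrable f) :
    Integrable fun k => f k * fourier m k :=
  hf.mul_bdd (continuous_fourier hm).aestronglyMeasurable
    (Eventually.of_forall (norm_fourier_le m))

theorem hasExpPairing_expPairing (hu : IsDualAdmissible γ g u) {m : L1}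
    (hm : m ∈ primalDomain γ) : HasExpPairing u (expPairing m g u) := by
  intro φ hφ hφ0
  obtain ⟨C, hC⟩ := hφ.exists_bound
  have hmi : Integrable m := L1.integrable_coeFn m
  have hw : Integrable fun k => u k * (fourier m k - expFun k) := hu.2.integrable_mul hm
  have hlim := (hu.tendsto_integral_comp_mul_mul_fourier hφ hmi).sub
    ((tendsto_integral_comp_mul_mul hφ.continuous hC hw).mono_left nhdsWithin_le_nhds)
  rw [hφ0, mul_one, one_mul] at hlim
  refine hlim.congr' ?_
  filter_upwards [self_mem_nhdsWithin] with ε hε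
  rw [← integral_sub (integrable_mul_fourier hmi (hu.integrable_comp_mul_mul hφ (ne_of_gt hε)))
    (hw.bdd_mul (f := fun k => φ (ε * k))
      (hφ.continuous.comp (continuous_const_mul ε)).aestronglyMeasurable
      (Eventually.of_forall fun k => hC _))]
  refine integral_congr_ae (Eventually.of_forall fun k => ?_)
  simp only
  ring

theorem HasExpPairing.unique {z z' : ℂ} (h : HasExpPairing u z) (h' : HasExpPairing u z') :
    z = z' := by
  obtain ⟨φ, hφ, hφ0⟩ := exists_isTestFunction_eq_one
  exact tendsto_nhds_unique (h φ hφ hφ0) (h' φ hφ hφ0)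

theorem norm_expPairing_le (hu : MemL2 (-γ) u) {m : L1} (hm : m ∈ primalDomain γ) :
    ‖expPairing m g u‖ ≤ 2 * Real.pi * ‖m‖ * ‖g‖ +
      normL2 γ (fun k => fourier m k - expFun k) * normL2 (-γ) u := by
  refine (norm_sub_le _ _).trans (add_le_add ?_ ?_)
  · rw [norm_mul, norm_mul, Complex.norm_real, Complex.norm_ofNat, Real.norm_eq_abs,
      abs_of_pos Real.pi_pos, mul_assoc (2 * Real.pi), L1.norm_eq_integral_norm,
      ← integral_mul_const]
    gcongr
    refine norm_integral_le_of_norm_le ((L1.integrable_coeFn m).norm.mul_const _)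
      (Eventually.of_forall fun y => ?_)
    rw [norm_mul]
    gcongr
    exact norm_zeroAtInfty_apply_le g _
  · rw [mul_comm]
    exact hu.norm_integral_mul_le hm

end Pairing

/-! ### Test functions as Fourier transforms -/

section InverseFourier

variable {φ : ℝ → ℂ} (hφ : IsTestFunction φ)
include hφ

/-- The inverse Fourier transform of a test function, as an element of `C₀(ℝ)`. -/
noncomputable def invFourier : C₀(ℝ, ℂ) where
  toFun x := (2 * Real.pi : ℂ)⁻¹ * fourier φ (-x)
  continuous_toFun := by
    have hcont := continuous_fourier hφ.integrable
    fun_prop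
  zero_at_infty' := by
    have hlim := (Real.zero_at_infty_fourier φ).comp
      ((Homeomorph.mulLeft₀ (-(2 * Real.pi)⁻¹)
        (by simp [Real.pi_ne_zero])).isClosedEmbedding.tendsto_cocompact)
    rw [← mul_zero (2 * Real.pi : ℂ)⁻¹]
    refine (hlim.congr fun x => ?_).const_mul _
    simp only [Function.comp, Homeomorph.coe_mulLeft₀, fourier_eq_fourier_div]
    ring_nf

theorem invFourier_apply (x : ℝ) :
    invFourier hφ x = (2 * Real.pi : ℂ)⁻¹ * fourier φ (-x) := rfl

theorem fourier_invFourier : fourier (invFourier hφ) = φ :=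
  funext (fourier_inversion hφ.continuous hφ.integrable hφ.integrable_fourier)

theorem isDualAdmissible_invFourier (γ : ℝ) : IsDualAdmissible γ (invFourier hφ) φ := by
  refine ⟨⟨hφ.integrable.locallyIntegrable, fun ψ hψ => ?_⟩, hφ.memL2 _⟩
  have hint : Integrable (invFourier hφ) := hφ.integrable_fourier.comp_neg.const_mul _
  rw [← integral_fourier_mul hint hψ.integrable]
  exact congrArg (fun f : ℝ → ℂ => ∫ k, f k * ψ k) (fourier_invFourier hφ).symm

theorem expPairing_invFourier {γ : ℝ} {m : L1} (hm : m ∈ primalDomain γ) :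
    expPairing m (invFourier hφ) φ = ∫ k, φ k * expFun k := by
  have hmi : Integrable m := L1.integrable_coeFn m
  have hw : Integrable fun k => φ k * (fourier m k - expFun k) := (hφ.memL2 (-γ)).integrable_mul hm
  have hparseval :
      2 * Real.pi * (∫ y, (m : ℝ → ℂ) y * invFourier hφ (-y)) = ∫ k, φ k * fourier m k := by
    simp only [mul_comm (φ _), integral_fourier_mul hmi hφ.integrable, ← integral_const_mul]
    refine integral_congr_ae (Eventually.of_forall fun y => ?_)
    have hpi : (Real.pi : ℂ) ≠ 0 := by exact_mod_cast Real.pi_ne_zero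
    simp only [invFourier_apply, neg_neg]
    field_simp
  rw [expPairing, hparseval, ← integral_sub (integrable_mul_fourier hmi hφ.integrable) hw]
  refine integral_congr_ae (Eventually.of_forall fun k => ?_)
  simp only
  ring

theorem invFourier_ne_zero (h : φ 0 ≠ 0) : invFourier hφ ≠ 0 := by
  intro hzero
  apply h
  rw [← fourier_invFourier hφ, hzero]
  simp [fourier]

end InverseFourier

/-! ### The scaling transformation -/

theorem ofReal_cpow_eq {α : ℝ} (hα : 0 < α) (x : ℝ) :
    (α : ℂ) ^ (-(Complex.I * (x : ℂ)) - 1) =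
      (α : ℂ)⁻¹ * Complex.exp (-(Complex.I * (Real.log α : ℂ) * x)) := by
  have h0 : (α : ℂ) ≠ 0 := by exact_mod_cast hα.ne'
  rw [Complex.cpow_sub _ _ h0, Complex.cpow_one, Complex.cpow_def_of_ne_zero h0,
    ← Complex.ofReal_log hα.le, div_eq_inv_mul]
  congr 2
  ring

theorem norm_ofReal_cpow {α : ℝ} (hα : 0 < α) (x : ℝ) :
    ‖(α : ℂ) ^ (-(Complex.I * (x : ℂ)) - 1)‖ = α⁻¹ := by
  rw [ofReal_cpow_eq hα, norm_mul, norm_cexp_neg_I_mul, norm_inv, Complex.norm_real,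
    Real.norm_eq_abs, abs_of_pos hα, mul_one]

theorem integrable_mul_cpow {m : ℝ → ℂ} (hm : Integrable m) {α : ℝ} (hα : 0 < α) :
    Integrable fun x : ℝ => m x * (α : ℂ) ^ (-(Complex.I * (x : ℂ)) - 1) := by
  refine hm.mul_bdd (c := α⁻¹) ?_ (Eventually.of_forall fun x => (norm_ofReal_cpow hα x).le)
  simp_rw [ofReal_cpow_eq hα]
  fun_prop

/-- The transformation `m(x) ↦ m(x) α^{-ix-1}` of `L¹(ℝ)`. -/
noncomputable def scale {α : ℝ} (hα : 0 < α) (m : L1) : L1 :=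
  (integrable_mul_cpow (L1.integrable_coeFn m) hα).toL1 _

theorem coeFn_scale {α : ℝ} (hα : 0 < α) (m : L1) :
    scale hα m =ᵐ[volume] fun x : ℝ => m x * (α : ℂ) ^ (-(Complex.I * (x : ℂ)) - 1) :=
  Integrable.coeFn_toL1 _

theorem norm_scale {α : ℝ} (hα : 0 < α) (m : L1) : ‖scale hα m‖ = α⁻¹ * ‖m‖ := by
  rw [L1.norm_eq_integral_norm, L1.norm_eq_integral_norm, ← integral_const_mul]
  refine integral_congr_ae ?_
  filter_upwards [coeFn_scale hα m] with x hx
  rw [hx, norm_mul, norm_ofReal_cpow hα, mul_comm]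

theorem fourier_scale {α : ℝ} (hα : 0 < α) (m : L1) (k : ℝ) :
    fourier (scale hα m) k = (α : ℂ)⁻¹ * fourier m (k + Real.log α) := by
  rw [fourier_congr_ae (coeFn_scale hα m), fourier, fourier, ← integral_const_mul]
  refine integral_congr_ae (Eventually.of_forall fun x => ?_)
  simp only [ofReal_cpow_eq hα]
  rw [show -(Complex.I * ((k + Real.log α : ℝ) : ℂ) * x) =
    -(Complex.I * (Real.log α : ℂ) * x) + -(Complex.I * k * x) by push_cast; ring, Complex.exp_add]
  ring

theorem fourier_scale_sub_expFun {α : ℝ} (hα : 0 < α) (m : L1) (k : ℝ) :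
    fourier (scale hα m) k - expFun k =
      (α : ℂ)⁻¹ * (fourier m (k + Real.log α) - expFun (k + Real.log α)) := by
  have h0 : (α : ℂ) ≠ 0 := by exact_mod_cast hα.ne'
  rw [fourier_scale hα, mul_sub]
  congr 1
  simp only [expFun, Real.exp_add, Real.exp_log hα]
  push_cast
  field_simp

theorem eLpNorm_expWeight_inv_mul_comp_add_log {α : ℝ} (hα : 0 < α) (γ : ℝ) {f : ℝ → ℂ}
    (hf : AEStronglyMeasurable f) :
    eLpNorm (fun k => (α : ℂ)⁻¹ * f (k + Real.log α)) 2 (expWeight γ) =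
      ENNReal.ofReal (α ^ (γ / 2 - 1)) * eLpNorm f 2 (expWeight γ) := by
  rw [eLpNorm_expWeight, eLpNorm_expWeight]
  set F : ℝ → ℂ := fun k => (Real.exp (-γ * k / 2) : ℂ) * f k with hF
  have hFm : AEStronglyMeasurable F := (by fun_prop : Continuous fun k : ℝ =>
    (Real.exp (-γ * k / 2) : ℂ)).aestronglyMeasurable.mul hf
  have hpow : α ^ (γ / 2 - 1) = α⁻¹ * Real.exp (γ * Real.log α / 2) := by
    rw [Real.rpow_sub_one hα.ne', Real.rpow_def_of_pos hα, div_eq_inv_mul]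
    congr 2
    ring
  have hshift : (fun k => (Real.exp (-γ * k / 2) : ℂ) * ((α : ℂ)⁻¹ * f (k + Real.log α))) =
      ((α ^ (γ / 2 - 1) : ℝ) : ℂ) • (F ∘ fun k => k + Real.log α) := by
    funext k
    have hexp : Real.exp (-γ * k / 2) =
        Real.exp (γ * Real.log α / 2) * Real.exp (-γ * (k + Real.log α) / 2) := by
      rw [← Real.exp_add]
      congr 1
      ring
    simp only [hF, Pi.smul_apply, Function.comp, smul_eq_mul, hpow, hexp]
    push_cast
    ring
  rw [hshift, eLpNorm_const_smul,
    eLpNorm_comp_measurePreserving hFm (measurePreserving_add_right volume (Real.log α)),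
    ← ofReal_norm, Complex.norm_real, Real.norm_eq_abs, abs_of_pos (Real.rpow_pos_of_pos hα _)]

theorem scale_mem_primalDomain {α : ℝ} (hα : 0 < α) {γ : ℝ} {m : L1} (hm : m ∈ primalDomain γ) :
    scale hα m ∈ primalDomain γ := by
  have hm' : MemL2 γ fun k => fourier m k - expFun k := hm
  have hmeas := hm'.aestronglyMeasurable
  refine ⟨?_, ?_⟩ <;> simp_rw [fourier_scale_sub_expFun hα]
  · refine aestronglyMeasurable_expWeight_iff.2 (AEStronglyMeasurable.const_mul ?_ _)
    exact hmeas.comp_measurePreserving (measurePreserving_add_right volume (Real.log α))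
  · rw [eLpNorm_expWeight_inv_mul_comp_add_log hα γ hmeas]
    exact ENNReal.mul_lt_top ENNReal.ofReal_lt_top hm'.2

theorem normL2_scale {α : ℝ} (hα : 0 < α) {γ : ℝ} {m : L1} (hm : m ∈ primalDomain γ) :
    normL2 γ (fun k => fourier (scale hα m) k - expFun k) =
      α ^ (γ / 2 - 1) * normL2 γ fun k => fourier m k - expFun k := by
  have hm' : MemL2 γ fun k => fourier m k - expFun k := hm
  simp_rw [fourier_scale_sub_expFun hα]
  rw [normL2, eLpNorm_expWeight_inv_mul_comp_add_log hα γ hm'.aestronglyMeasurable,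
    ENNReal.toReal_mul, ENNReal.toReal_ofReal (Real.rpow_nonneg hα.le _), normL2]

theorem primalFunctional_scale {α : ℝ} (hα : 0 < α) {γ : ℝ} {m : L1}
    (hm : m ∈ primalDomain γ) : primalFunctional γ (scale hα m) = primalFunctional γ m := by
  rw [primalFunctional, primalFunctional, normL2_scale hα hm, norm_scale,
    Real.mul_rpow (by positivity) (norm_nonneg _), mul_pow]
  have hcancel : α⁻¹ ^ (γ - 2) * (α ^ (γ / 2 - 1)) ^ 2 = 1 := by
    rw [← Real.rpow_mul_natCast hα.le, Real.inv_rpow hα.le, ← Real.rpow_neg hα.le,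
      ← Real.rpow_add hα]
    rw [show -(γ - 2) + (γ / 2 - 1) * ((2 : ℕ) : ℝ) = 0 by push_cast; ring, Real.rpow_zero]
  linear_combination (‖m‖ ^ (γ - 2) * normL2 γ (fun k => fourier m k - expFun k) ^ 2) * hcancel

/-! ### Uniqueness of minimizers -/

theorem primalFunctional_nonneg (γ : ℝ) (m : L1) : 0 ≤ primalFunctional γ m := by
  unfold primalFunctional
  positivity

theorem bddBelow_primalFunctional (γ : ℝ) : BddBelow (primalFunctional γ '' primalDomain γ) :=
  ⟨0, by rintro _ ⟨m, -, rfl⟩; exact primalFunctional_nonneg γ m⟩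

theorem primalInf_le {γ : ℝ} {m : L1} (hm : m ∈ primalDomain γ) :
    primalInf γ ≤ primalFunctional γ m :=
  csInf_le (bddBelow_primalFunctional γ) ⟨m, hm, rfl⟩

theorem fourier_add_L1 (m m' : L1) (k : ℝ) :
    fourier (m + m' : L1) k = fourier m k + fourier m' k := by
  rw [fourier_congr_ae (Lp.coeFn_add m m'), fourier, fourier, fourier,
    ← integral_add (integrable_mul_cexp (L1.integrable_coeFn m) k)
      (integrable_mul_cexp (L1.integrable_coeFn m') k)]
  refine integral_congr_ae (Eventually.of_forall fun x => ?_)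
  simp only [Pi.add_apply]
  ring

theorem fourier_smul_L1 (c : ℂ) (m : L1) (k : ℝ) :
    fourier (c • m : L1) k = c * fourier m k := by
  rw [fourier_congr_ae (Lp.coeFn_smul c m), fourier, fourier, ← integral_const_mul]
  refine integral_congr_ae (Eventually.of_forall fun x => ?_)
  simp only [Pi.smul_apply, smul_eq_mul]
  ring

theorem eq_of_fourier_ae_eq {m m' : L1} (h : fourier m =ᵐ[volume] fourier m') : m = m' := by
  have hdiff : fourier (m + (-1 : ℂ) • m' : L1) =ᵐ[volume] 0 := by
    filter_upwards [h] with k hk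
    rw [fourier_add_L1, fourier_smul_L1, hk]
    simp
  have hzero : m + (-1 : ℂ) • m' = 0 :=
    Lp.ext ((ae_eq_zero_of_fourier_ae_eq_zero (L1.integrable_coeFn _) hdiff).trans
      (Lp.coeFn_zero ℂ 1 volume).symm)
  simpa [add_neg_eq_zero] using hzero

theorem IsPrimalMinimizer.scale {γ : ℝ} {m : L1} (hm : IsPrimalMinimizer γ m) {α : ℝ}
    (hα : 0 < α) : IsPrimalMinimizer γ (scale hα m) :=
  ⟨scale_mem_primalDomain hα hm.1, (primalFunctional_scale hα hm.1).trans hm.2⟩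

theorem memLp_of_mem_primalDomain {γ : ℝ} {m : L1} (hm : m ∈ primalDomain γ) :
    MemLp (fun k => fourier m k - expFun k) 2 (expWeight γ) :=
  hm

/-- The element `m̂ - exp` of the Hilbert space `L²_γ(ℝ)`, for `m` in the effective domain. -/
noncomputable def residual {γ : ℝ} {m : L1} (hm : m ∈ primalDomain γ) : Lp ℂ 2 (expWeight γ) :=
  (memLp_of_mem_primalDomain hm).toLp

section Residual

variable {γ : ℝ} {m m' : L1}

theorem norm_residual (hm : m ∈ primalDomain γ) :
    ‖residual hm‖ = normL2 γ fun k => fourier m k - expFun k :=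
  Lp.norm_toLp _ hm

theorem eq_of_residual_eq (hm : m ∈ primalDomain γ) (hm' : m' ∈ primalDomain γ)
    (h : residual hm = residual hm') : m = m' := by
  have hae := (MemLp.toLp_eq_toLp_iff (memLp_of_mem_primalDomain hm)
    (memLp_of_mem_primalDomain hm')).1 h
  refine eq_of_fourier_ae_eq ?_
  filter_upwards [(absolutelyContinuous_expWeight γ).ae_eq hae] with k hk
  exact sub_left_injective hk

theorem fourier_midpoint_sub_expFun (m m' : L1) :
    (fun k => fourier ((2⁻¹ : ℂ) • (m + m') : L1) k - expFun k) = (2⁻¹ : ℂ) •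
      ((fun k => fourier m k - expFun k) + fun k => fourier m' k - expFun k) := by
  funext k
  simp only [fourier_smul_L1, fourier_add_L1, Pi.smul_apply, Pi.add_apply, smul_eq_mul]
  ring

theorem midpoint_mem_primalDomain (hm : m ∈ primalDomain γ) (hm' : m' ∈ primalDomain γ) :
    (2⁻¹ : ℂ) • (m + m') ∈ primalDomain γ := by
  rw [primalDomain, Set.mem_ofPred_eq, fourier_midpoint_sub_expFun]
  exact (MemLp.add hm hm').const_smul _

theorem residual_midpoint (hm : m ∈ primalDomain γ) (hm' : m' ∈ primalDomain γ) :
    residual (midpoint_mem_primalDomain hm hm') = (2⁻¹ : ℂ) • (residual hm + residual hm') := by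
  rw [residual, residual, residual, ← MemLp.toLp_add, ← MemLp.toLp_const_smul]
  exact MemLp.toLp_congr _ _ (by rw [fourier_midpoint_sub_expFun])

theorem IsPrimalMinimizer.eq_of_norm_eq (hγ : 2 < γ) (hm : IsPrimalMinimizer γ m)
    (hm' : IsPrimalMinimizer γ m') (hnorm : ‖m‖ = ‖m'‖) : m = m' := by
  have hpos : 0 < ‖m‖ ^ (γ - 2) :=
    Real.rpow_pos_of_pos (norm_pos_iff.2 (ne_zero_of_mem_primalDomain hγ hm.1)) _
  have hvalue : ‖m‖ ^ (γ - 2) * ‖residual hm.1‖ ^ 2 = primalInf γ := by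
    rw [norm_residual, ← hm.2, primalFunctional]
  have hvalue' : ‖m‖ ^ (γ - 2) * ‖residual hm'.1‖ ^ 2 = primalInf γ := by
    rw [norm_residual, ← hm'.2, primalFunctional, hnorm]
  have hresidual : ‖residual hm.1‖ = ‖residual hm'.1‖ :=
    (sq_eq_sq₀ (norm_nonneg _) (norm_nonneg _)).1
      (mul_left_cancel₀ hpos.ne' (hvalue.trans hvalue'.symm))
  have hmid := midpoint_mem_primalDomain hm.1 hm'.1
  have hmid_norm : ‖(2⁻¹ : ℂ) • (m + m')‖ ≤ ‖m‖ := by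
    rw [norm_smul, norm_inv, Complex.norm_ofNat]
    linarith [norm_add_le m m']
  have hmid_residual : ‖residual hm.1‖ ≤ ‖residual hmid‖ := by
    refine le_of_sq_le_sq (le_of_mul_le_mul_left ?_ hpos) (norm_nonneg _)
    calc ‖m‖ ^ (γ - 2) * ‖residual hm.1‖ ^ 2
        ≤ ‖(2⁻¹ : ℂ) • (m + m')‖ ^ (γ - 2) * ‖residual hmid‖ ^ 2 := by
          rw [hvalue, norm_residual]
          exact primalInf_le hmid
      _ ≤ ‖m‖ ^ (γ - 2) * ‖residual hmid‖ ^ 2 := by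
          gcongr
  refine eq_of_residual_eq hm.1 hm'.1 (eq_of_norm_eq_of_norm_add_eq hresidual ?_)
  refine le_antisymm (norm_add_le _ _) ?_
  rw [residual_midpoint hm.1 hm'.1, norm_smul, norm_inv, Complex.norm_ofNat] at hmid_residual
  linarith

end Residual

theorem isPrimalMinimizer_iff {γ : ℝ} (hγ : 2 < γ) {m : L1} (hm : IsPrimalMinimizer γ m)
    (m' : L1) : IsPrimalMinimizer γ m' ↔ ∃ α : ℝ, 0 < α ∧
      m' =ᵐ[volume] fun x : ℝ => m x * (α : ℂ) ^ (-(Complex.I * (x : ℂ)) - 1) := by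
  constructor
  · intro hm'
    have hpos := norm_pos_iff.2 (ne_zero_of_mem_primalDomain hγ hm.1)
    have hpos' := norm_pos_iff.2 (ne_zero_of_mem_primalDomain hγ hm'.1)
    have hα : 0 < ‖m‖ / ‖m'‖ := div_pos hpos hpos'
    refine ⟨_, hα, ?_⟩
    have heq := hm'.eq_of_norm_eq hγ (hm.scale hα) (by rw [norm_scale]; field_simp)
    have hcoe := coeFn_scale hα m
    rwa [← heq] at hcoe
  · rintro ⟨α, hα, h⟩
    rw [Lp.ext (h.trans (coeFn_scale hα m).symm)]
    exact hm.scale hα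

/-! ### Weak duality -/

theorem nonpos_of_forall_le_mul_rpow {c Q t : ℝ} (hc : 0 < c)
    (h : ∀ α : ℝ, 0 < α → t ≤ Q * α ^ c) : t ≤ 0 := by
  have hlim : Tendsto (fun α : ℝ => Q * α ^ c) (𝓝[>] 0) (𝓝 (Q * 0 ^ c)) :=
    ((Real.continuousAt_rpow_const 0 c (Or.inr hc.le)).tendsto.mono_left
      nhdsWithin_le_nhds).const_mul Q
  rw [Real.zero_rpow hc.ne', mul_zero] at hlim
  exact ge_of_tendsto hlim (eventually_nhdsWithin_of_forall h)

theorem nonpos_of_forall_le_mul_inv {P t : ℝ} (h : ∀ α : ℝ, 0 < α → t ≤ P * α⁻¹) : t ≤ 0 :=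
  nonpos_of_forall_le_mul_rpow one_pos fun α hα => by simpa using h α⁻¹ (inv_pos.2 hα)

theorem rpow_eq_rpow_sub_two_mul_sq {x γ : ℝ} (hx : 0 ≤ x) (hγ : γ ≠ 0) :
    x ^ γ = x ^ (γ - 2) * x ^ 2 := by
  have hadd := Real.rpow_add_natCast' (x := x) (y := γ - 2) (n := 2) hx (by simpa using hγ)
  rwa [Nat.cast_ofNat, sub_add_cancel] at hadd

-- The right-hand side is minimal at `α = β ^ (2 / γ)` with `β = 2 P / ((γ - 2) Q)`.
theorem rpow_le_of_forall_le_mul_inv_add_mul_rpow_of_pos {γ P Q t : ℝ} (hγ : 2 < γ) (hP : 0 < P)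
    (hQ : 0 < Q) (ht : 0 ≤ t) (h : ∀ α : ℝ, 0 < α → t ≤ P * α⁻¹ + Q * α ^ (γ / 2 - 1)) :
    t ^ γ ≤ γ ^ γ / (4 * (γ - 2) ^ (γ - 2)) * (P ^ (γ - 2) * Q ^ 2) := by
  have hγ2 : 0 < γ - 2 := by linarith
  have hγ0 : 0 < γ := by linarith
  set β := 2 * P / ((γ - 2) * Q) with hβ
  have hβ0 : 0 < β := by positivity
  set α := β ^ (2 / γ) with hα
  have hα0 : 0 < α := by positivity
  have hα_pow_sub : α ^ (γ / 2 - 1) = β * α⁻¹ := by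
    rw [Real.rpow_sub_one hα0.ne', hα, ← Real.rpow_mul hβ0.le, div_eq_mul_inv,
      show 2 / γ * (γ / 2) = 1 by field_simp, Real.rpow_one]
  have hα_pow : α ^ γ = β ^ 2 := by
    rw [hα, ← Real.rpow_mul hβ0.le, div_mul_cancel₀ _ hγ0.ne', Real.rpow_two]
  have hmin : t ≤ α⁻¹ * (P * (γ / (γ - 2))) := by
    refine (h α hα0).trans_eq ?_
    rw [hα_pow_sub, hβ]
    field_simp
    ring
  calc t ^ γ ≤ (α⁻¹ * (P * (γ / (γ - 2)))) ^ γ := Real.rpow_le_rpow ht hmin hγ0.le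
    _ = (β ^ 2)⁻¹ * (P ^ γ * (γ ^ γ / (γ - 2) ^ γ)) := by
      rw [Real.mul_rpow (by positivity) (by positivity), Real.mul_rpow hP.le (by positivity),
        Real.inv_rpow hα0.le, hα_pow, Real.div_rpow hγ0.le hγ2.le]
    _ = γ ^ γ / (4 * (γ - 2) ^ (γ - 2)) * (P ^ (γ - 2) * Q ^ 2) := by
      rw [rpow_eq_rpow_sub_two_mul_sq hP.le hγ0.ne', rpow_eq_rpow_sub_two_mul_sq hγ2.le hγ0.ne', hβ]
      field_simp
      ring

theorem rpow_le_of_forall_le_mul_inv_add_mul_rpow {γ P Q t : ℝ} (hγ : 2 < γ) (hP : 0 ≤ P)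
    (hQ : 0 ≤ Q) (ht : 0 ≤ t) (h : ∀ α : ℝ, 0 < α → t ≤ P * α⁻¹ + Q * α ^ (γ / 2 - 1)) :
    t ^ γ ≤ γ ^ γ / (4 * (γ - 2) ^ (γ - 2)) * (P ^ (γ - 2) * Q ^ 2) := by
  have : 0 < γ - 2 := by linarith
  have of_nonpos (ht' : t ≤ 0) :
      t ^ γ ≤ γ ^ γ / (4 * (γ - 2) ^ (γ - 2)) * (P ^ (γ - 2) * Q ^ 2) := by
    rw [le_antisymm ht' ht, Real.zero_rpow (by linarith)]
    positivity
  rcases hP.eq_or_lt with rfl | hP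
  · exact of_nonpos (nonpos_of_forall_le_mul_rpow (Q := Q) (c := γ / 2 - 1) (by linarith)
      (by simpa only [zero_mul, zero_add] using h))
  rcases hQ.eq_or_lt with rfl | hQ
  · exact of_nonpos (nonpos_of_forall_le_mul_inv (P := P)
      (by simpa only [zero_mul, add_zero] using h))
  exact rpow_le_of_forall_le_mul_inv_add_mul_rpow_of_pos hγ hP hQ ht h

/-- The constant relating the primal infimum to the dual supremum. -/
noncomputable def dualityConst (γ : ℝ) : ℝ :=
  4 * (γ - 2) ^ (γ - 2) / ((2 * Real.pi) ^ (γ - 2) * γ ^ γ)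

theorem dualityConst_pos {γ : ℝ} (hγ : 2 < γ) : 0 < dualityConst γ := by
  have : 0 < γ := by linarith
  have : 0 < γ - 2 := by linarith
  unfold dualityConst
  positivity

-- The pairing does not depend on `m`, so it may be computed along the scaling orbit of `m`.
theorem dualityConst_mul_norm_rpow_le {γ : ℝ} (hγ : 2 < γ) {g : C₀(ℝ, ℂ)} {u : ℝ → ℂ}
    (hu : IsDualAdmissible γ g u) {z : ℂ} (hz : HasExpPairing u z) {m : L1}
    (hm : m ∈ primalDomain γ) :
    dualityConst γ * ‖z‖ ^ γ ≤
      primalFunctional γ m * (‖g‖ ^ (γ - 2) * normL2 (-γ) u ^ 2) := by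
  have : 0 < γ := by linarith
  have : 0 < γ - 2 := by linarith
  have hz_rpow := rpow_le_of_forall_le_mul_inv_add_mul_rpow hγ (P := 2 * Real.pi * ‖m‖ * ‖g‖)
    (Q := normL2 γ (fun k => fourier m k - expFun k) * normL2 (-γ) u) (t := ‖z‖)
    (by positivity) (mul_nonneg (normL2_nonneg _ _) (normL2_nonneg _ _)) (norm_nonneg _)
    fun α hα => by
      have hmα := scale_mem_primalDomain hα hm
      rw [hz.unique (hasExpPairing_expPairing hu hmα)]
      refine (norm_expPairing_le hu.2 hmα).trans_eq ?_
      rw [norm_scale, normL2_scale hα hm]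
      ring
  refine (mul_le_mul_of_nonneg_left hz_rpow (dualityConst_pos hγ).le).trans_eq ?_
  rw [Real.mul_rpow (by positivity) (norm_nonneg _), Real.mul_rpow (by positivity) (norm_nonneg _),
    primalFunctional, dualityConst]
  field_simp

/-! ### The dual supremum -/

theorem dualValues_nonempty {γ : ℝ} (hγ : 2 < γ) : (dualValues γ).Nonempty := by
  obtain ⟨m, hm⟩ := primalDomain_nonempty hγ
  obtain ⟨φ, hφ, hφ0⟩ := exists_isTestFunction_eq_one
  exact ⟨_, invFourier hφ, φ, _, invFourier_ne_zero hφ (by simp [hφ0]),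
    isDualAdmissible_invFourier hφ γ,
    hasExpPairing_expPairing (isDualAdmissible_invFourier hφ γ) hm, rfl⟩

theorem dualityConst_mul_le_primalFunctional {γ : ℝ} (hγ : 2 < γ) {m : L1}
    (hm : m ∈ primalDomain γ) {r : ℝ} (hr : r ∈ dualValues γ) :
    dualityConst γ * r ≤ primalFunctional γ m := by
  obtain ⟨g, u, z, -, hu, hz, rfl⟩ := hr
  rw [← mul_div_assoc]
  exact div_le_of_le_mul₀ (by positivity) (primalFunctional_nonneg γ m)
    (dualityConst_mul_norm_rpow_le hγ hu hz hm)

theorem bddAbove_dualValues {γ : ℝ} (hγ : 2 < γ) : BddAbove (dualValues γ) := by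
  obtain ⟨m, hm⟩ := primalDomain_nonempty hγ
  exact ⟨primalFunctional γ m / dualityConst γ, fun r hr =>
    (le_div_iff₀' (dualityConst_pos hγ)).2 (dualityConst_mul_le_primalFunctional hγ hm hr)⟩

theorem dualityConst_mul_sSup_le {γ : ℝ} (hγ : 2 < γ) {m : L1} (hm : m ∈ primalDomain γ) :
    dualityConst γ * sSup (dualValues γ) ≤ primalFunctional γ m :=
  (le_div_iff₀' (dualityConst_pos hγ)).1 <| csSup_le (dualValues_nonempty hγ) fun _ hr =>
    (le_div_iff₀' (dualityConst_pos hγ)).2 (dualityConst_mul_le_primalFunctional hγ hm hr)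

theorem sSup_dualValues_nonneg (γ : ℝ) : 0 ≤ sSup (dualValues γ) := by
  refine Real.sSup_nonneg ?_
  rintro _ ⟨g, u, z, -, -, -, rfl⟩
  positivity

theorem norm_rpow_le_sSup_dualValues_mul {γ : ℝ} (hγ : 2 < γ) {g : C₀(ℝ, ℂ)} {u : ℝ → ℂ}
    (hu : IsDualAdmissible γ g u) {z : ℂ} (hz : HasExpPairing u z) :
    ‖z‖ ^ γ ≤ sSup (dualValues γ) * (‖g‖ ^ (γ - 2) * normL2 (-γ) u ^ 2) := by
  have hnorms : 0 ≤ ‖g‖ ^ (γ - 2) * normL2 (-γ) u ^ 2 := by positivity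
  rcases hnorms.eq_or_lt with hzero | hpos
  · obtain ⟨m, hm⟩ := primalDomain_nonempty hγ
    have hle := dualityConst_mul_norm_rpow_le hγ hu hz hm
    rw [← hzero, mul_zero] at hle ⊢
    exact nonpos_of_mul_nonpos_right hle (dualityConst_pos hγ)
  · have hg : g ≠ 0 := by
      rintro rfl
      rw [norm_zero, Real.zero_rpow (by linarith), zero_mul] at hpos
      exact hpos.false
    rw [← div_le_iff₀ hpos]
    exact le_csSup (bddAbove_dualValues hγ) ⟨g, u, z, hg, hu, hz, rfl⟩

theorem norm_integral_mul_expFun_le {γ : ℝ} (hγ : 2 < γ) {φ : ℝ → ℂ} (hφ : IsTestFunction φ) :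
    ‖∫ k, φ k * expFun k‖ ≤
      sSup (dualValues γ) ^ γ⁻¹ * ‖(invFourier hφ, MemLp.toLp φ (hφ.memL2 (-γ)))‖ := by
  have hγ0 : 0 < γ := by linarith
  have hφ_adm := isDualAdmissible_invFourier hφ γ
  obtain ⟨m, hm⟩ := primalDomain_nonempty hγ
  have hpairing := hasExpPairing_expPairing hφ_adm hm
  rw [expPairing_invFourier hφ hm] at hpairing
  have hrpow := norm_rpow_le_sSup_dualValues_mul hγ hφ_adm hpairing
  set p := (invFourier hφ, MemLp.toLp φ (hφ.memL2 (-γ)))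
  have hfst : ‖invFourier hφ‖ ≤ ‖p‖ := norm_fst_le p
  have hsnd : normL2 (-γ) φ ≤ ‖p‖ :=
    (Lp.norm_toLp φ (hφ.memL2 (-γ))).symm.trans_le (norm_snd_le p)
  have hnorms : ‖invFourier hφ‖ ^ (γ - 2) * normL2 (-γ) φ ^ 2 ≤ ‖p‖ ^ γ := by
    have := normL2_nonneg (-γ) φ
    rw [rpow_eq_rpow_sub_two_mul_sq (norm_nonneg p) hγ0.ne']
    gcongr
  calc ‖∫ k, φ k * expFun k‖ = (‖∫ k, φ k * expFun k‖ ^ γ) ^ γ⁻¹ :=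
        (Real.rpow_rpow_inv (norm_nonneg _) hγ0.ne').symm
    _ ≤ (sSup (dualValues γ) * ‖p‖ ^ γ) ^ γ⁻¹ := by
        have hD := sSup_dualValues_nonneg γ
        gcongr
        exact hrpow.trans (by gcongr)
    _ = sSup (dualValues γ) ^ γ⁻¹ * ‖p‖ := by
        rw [Real.mul_rpow (sSup_dualValues_nonneg γ) (by positivity),
          Real.rpow_rpow_inv (norm_nonneg _) hγ0.ne']

theorem rpow_sub_two_mul_sq_le {γ a b : ℝ} (hγ : 2 < γ) (ha : 0 ≤ a) (hb : 0 ≤ b) :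
    a ^ (γ - 2) * b ^ 2 ≤ 4 * (γ - 2) ^ (γ - 2) / γ ^ γ * (a + b) ^ γ := by
  have hγ0 : 0 < γ := by linarith
  have hγ2 : 0 < γ - 2 := by linarith
  have amgm : (a * (γ / (γ - 2))) ^ ((γ - 2) / γ) * (b * (γ / 2)) ^ (2 / γ) ≤ a + b := by
    refine (Real.geom_mean_le_arith_mean2_weighted (by positivity) (by positivity) (by positivity)
      (by positivity) (by field_simp; ring)).trans_eq ?_
    field_simp
  have amgm_rpow : (a * (γ / (γ - 2))) ^ (γ - 2) * (b * (γ / 2)) ^ 2 ≤ (a + b) ^ γ := by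
    have := Real.rpow_le_rpow (by positivity) amgm hγ0.le
    rwa [Real.mul_rpow (by positivity) (by positivity), ← Real.rpow_mul (by positivity),
      ← Real.rpow_mul (by positivity), div_mul_cancel₀ _ hγ0.ne', div_mul_cancel₀ _ hγ0.ne',
      Real.rpow_two] at this
  calc a ^ (γ - 2) * b ^ 2
      = 4 * (γ - 2) ^ (γ - 2) / γ ^ γ *
          ((a * (γ / (γ - 2))) ^ (γ - 2) * (b * (γ / 2)) ^ 2) := by
        rw [Real.mul_rpow ha (by positivity), Real.div_rpow hγ0.le hγ2.le,
          rpow_eq_rpow_sub_two_mul_sq hγ0.le hγ0.ne']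
        field_simp
        ring
    _ ≤ 4 * (γ - 2) ^ (γ - 2) / γ ^ γ * (a + b) ^ γ := by gcongr

/-! ### Strong duality and attainment -/

theorem integral_expWeight (γ : ℝ) (f : ℝ → ℂ) :
    ∫ k, f k ∂expWeight γ = ∫ k, (Real.exp (-γ * k) : ℂ) * f k := by
  rw [expWeight, integral_withDensity_eq_integral_toReal_smul (by fun_prop)
    (Eventually.of_forall fun _ => ENNReal.ofReal_lt_top)]
  simp only [ENNReal.toReal_ofReal (Real.exp_pos _).le, Complex.real_smul]

theorem eLpNorm_exp_mul_conj (γ : ℝ) (v : ℝ → ℂ) :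
    eLpNorm (fun k => (Real.exp (γ * k) : ℂ) * starRingEnd ℂ (v k)) 2 (expWeight γ) =
      eLpNorm v 2 (expWeight (-γ)) := by
  rw [eLpNorm_expWeight, eLpNorm_expWeight]
  refine eLpNorm_congr_norm_ae (Eventually.of_forall fun k => ?_)
  simp only [norm_mul, Complex.norm_real, RCLike.norm_conj, Real.norm_eq_abs, Real.abs_exp]
  rw [← mul_assoc, ← Real.exp_add]
  ring_nf

theorem MemL2.exp_mul_conj {γ : ℝ} {v : ℝ → ℂ} (hv : MemL2 (-γ) v) :
    MemL2 γ fun k => (Real.exp (γ * k) : ℂ) * starRingEnd ℂ (v k) :=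
  ⟨aestronglyMeasurable_expWeight_iff.2
    ((by fun_prop : Continuous fun k : ℝ => (Real.exp (γ * k) : ℂ)).aestronglyMeasurable.mul
      (Complex.continuous_conj.comp_aestronglyMeasurable hv.aestronglyMeasurable)),
    (eLpNorm_exp_mul_conj γ v).trans_lt hv.2⟩

theorem exists_memL2_forall_apply_toLp_eq_integral {γ : ℝ}
    (W : StrongDual ℂ (Lp ℂ 2 (expWeight (-γ)))) :
    ∃ w : ℝ → ℂ, MemL2 γ w ∧ normL2 γ w = ‖W‖ ∧
      ∀ (u : ℝ → ℂ) (hu : MemL2 (-γ) u), W (MemLp.toLp u hu) = ∫ k, u k * w k := by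
  set v := (InnerProductSpace.toDual ℂ _).symm W with hv
  refine ⟨_, MemL2.exp_mul_conj (Lp.memLp v), ?_, fun u hu => ?_⟩
  · rw [normL2, eLpNorm_exp_mul_conj, ← Lp.norm_def, hv, LinearIsometryEquiv.norm_map]
  · have hW : W (MemLp.toLp u hu) = inner ℂ v (MemLp.toLp u hu) := by
      rw [hv, InnerProductSpace.toDual_symm_apply]
    have hinner : ∫ k, inner ℂ (v k) (MemLp.toLp u hu k) ∂expWeight (-γ) =
        ∫ k, u k * starRingEnd ℂ (v k) ∂expWeight (-γ) := by
      refine integral_congr_ae ?_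
      filter_upwards [MemLp.coeFn_toLp hu] with k hk
      rw [hk, RCLike.inner_apply]
    rw [hW, L2.inner_def, hinner, integral_expWeight]
    simp only [neg_neg, mul_left_comm]

theorem memL2_indicator_Iio_exp_neg_mul {b γ : ℝ} (hb : 2 * b < γ) :
    MemL2 (-γ) ((Set.Iio 0).indicator fun k => (Real.exp (-b * k) : ℂ)) := by
  rw [memL2_iff_memLp_exp_mul, memLp_two_iff_integrable_sq_norm (by measurability)]
  have hexp : IntegrableOn (fun k => Real.exp ((γ - 2 * b) * k)) (Set.Iio (0 : ℝ)) :=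
    (integrableOn_exp_mul_Iic (by linarith) 0).mono_set Set.Iio_subset_Iic_self
  refine (hexp.integrable_indicator measurableSet_Iio).congr (Eventually.of_forall fun k => ?_)
  by_cases hk : k ∈ Set.Iio (0 : ℝ)
  · simp only [Set.indicator_of_mem hk, norm_mul, Complex.norm_real, Real.norm_eq_abs,
      Real.abs_exp]
    rw [← Real.exp_add, ← Real.exp_nat_mul]
    congr 1
    push_cast
    ring
  · simp [Set.indicator_of_notMem hk]

theorem MemL2.integrableOn_exp_mul_norm_comp_neg {b γ : ℝ} (hb : 2 * b < γ) {w : ℝ → ℂ}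
    (hw : MemL2 γ w) : IntegrableOn (fun s => Real.exp (b * s) * ‖w (-s)‖) (Set.Ioi 0) := by
  have hint := ((memL2_indicator_Iio_exp_neg_mul hb).integrable_mul hw).norm.comp_neg
  refine hint.integrableOn.congr_fun (fun s hs => ?_) measurableSet_Ioi
  have hs' : -s ∈ Set.Iio (0 : ℝ) := Set.mem_Iio.2 (neg_neg_iff_pos.2 hs)
  simp only [Set.indicator_of_mem hs', norm_mul, Complex.norm_real, Real.norm_eq_abs, Real.abs_exp,
    neg_mul_neg]

theorem continuous_expFun : Continuous expFun := by
  unfold expFun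
  fun_prop

theorem locallyIntegrable_expFun : LocallyIntegrable expFun := continuous_expFun.locallyIntegrable

theorem integrableOn_exp_mul_norm_expFun_neg {b : ℝ} (hb : b < 1) :
    IntegrableOn (fun s => Real.exp (b * s) * ‖expFun (-s)‖) (Set.Ioi 0) := by
  refine (exp_neg_integrableOn_Ioi 0 (sub_pos.2 hb)).congr_fun (fun s _ => ?_) measurableSet_Ioi
  simp only [expFun, Complex.norm_real, Real.norm_eq_abs, Real.abs_exp, ← Real.exp_add]
  ring_nf

theorem MemL2.integrableOn_exp_mul_norm_expFun_sub_comp_neg {b γ : ℝ} (hb : b < 1)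
    (hbγ : 2 * b < γ) {w : ℝ → ℂ} (hw : MemL2 γ w) :
    IntegrableOn (fun s => Real.exp (b * s) * ‖expFun (-s) - w (-s)‖) (Set.Ioi 0) := by
  refine ((integrableOn_exp_mul_norm_expFun_neg hb).add
    (hw.integrableOn_exp_mul_norm_comp_neg hbγ)).mono' ?_ (Eventually.of_forall fun s => ?_)
  · have hw_neg : AEStronglyMeasurable (fun s => w (-s)) volume :=
      hw.aestronglyMeasurable.comp_measurePreserving (Measure.measurePreserving_neg _)
    exact ((by fun_prop : Continuous fun s : ℝ => Real.exp (b * s)).aestronglyMeasurable.mul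
      ((continuous_expFun.comp continuous_neg).aestronglyMeasurable.sub hw_neg).norm).restrict
  · rw [Real.norm_of_nonneg (by positivity), Pi.add_apply, ← mul_add]
    gcongr
    exact norm_sub_le _ _

theorem MemL2.integrableOn_exp_mul_norm_of_const_mul_neg_ae_eq {b γ : ℝ} (hb : b < 1)
    (hbγ : 2 * b < γ) {w T : ℝ → ℂ} (hw : MemL2 γ w) {c : ℂ} (hc : c ≠ 0)
    (hT : (fun k => c * T (-k)) =ᵐ[volume] fun k => expFun k - w k) :
    IntegrableOn (fun s => Real.exp (b * s) * ‖T s‖) (Set.Ioi 0) := by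
  refine Integrable.congr ((hw.integrableOn_exp_mul_norm_expFun_sub_comp_neg hb hbγ).const_mul
    ‖c‖⁻¹) (ae_restrict_of_ae ?_)
  have hT_neg := (Measure.measurePreserving_neg (volume : Measure ℝ)).quasiMeasurePreserving.ae hT
  filter_upwards [hT_neg] with s hs
  have := norm_ne_zero_iff.2 hc
  rw [← hs, neg_neg, norm_mul]
  field_simp

theorem IsTestFunction.integrable_mul {u φ : ℝ → ℂ} (hφ : IsTestFunction φ)
    (hu : LocallyIntegrable u) : Integrable fun k => φ k * u k :=
  hu.integrable_smul_left_of_hasCompactSupport hφ.continuous hφ.2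

theorem ae_eq_of_forall_integral_testFunction_mul_eq {u v : ℝ → ℂ} (hu : LocallyIntegrable u)
    (hv : LocallyIntegrable v)
    (h : ∀ φ, IsTestFunction φ → ∫ k, φ k * u k = ∫ k, φ k * v k) : u =ᵐ[volume] v := by
  have hsub : u - v =ᵐ[volume] 0 :=
    ae_eq_zero_of_integral_contDiff_smul_eq_zero (hu.sub hv) fun g hg hgc => by
      have hφ := isTestFunction_ofReal hg hgc
      simp only [Pi.sub_apply, Complex.real_smul, mul_sub]
      rw [integral_sub (hφ.integrable_mul hu) (hφ.integrable_mul hv), h _ hφ, sub_self]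
  filter_upwards [hsub] with k hk
  exact sub_eq_zero.1 hk

section Reconstruction

variable {ν : Measure ℝ} {h w : ℝ → ℂ} {γ : ℝ}

theorem integral_invFourier_mul [SFinite ν] {φ : ℝ → ℂ} (hφ : IsTestFunction φ)
    (hh : Integrable h ν) :
    ∫ x, invFourier hφ x * h x ∂ν =
      ∫ k, φ k * ((2 * Real.pi : ℂ)⁻¹ * fourierMeasure ν h (-k)) := by
  have hφ_neg (x : ℝ) : fourierMeasure volume (fun k => φ (-k)) x = fourier φ (-x) := by
    rw [fourierMeasure, fourier, ← integral_neg_eq_self]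
    simp
  calc ∫ x, invFourier hφ x * h x ∂ν
      = (2 * Real.pi : ℂ)⁻¹ * ∫ x, h x * fourierMeasure volume (fun k => φ (-k)) x ∂ν := by
        simp only [invFourier_apply, hφ_neg, ← integral_const_mul, mul_assoc, mul_comm (h _)]
    _ = (2 * Real.pi : ℂ)⁻¹ * ∫ k, fourierMeasure ν h (-k) * φ k := by
        rw [← integral_fourierMeasure_mul hh hφ.integrable.comp_neg, ← integral_neg_eq_self]
        simp only [neg_neg]
    _ = ∫ k, φ k * ((2 * Real.pi : ℂ)⁻¹ * fourierMeasure ν h (-k)) := by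
        simp only [← integral_const_mul, mul_comm (φ _), mul_assoc]

theorem fourierMeasure_neg_ae_eq_expFun_sub [SFinite ν] (hh : Integrable h ν) (hw : MemL2 γ w)
    (hpair : ∀ (φ : ℝ → ℂ) (hφ : IsTestFunction φ),
      ∫ x, invFourier hφ x * h x ∂ν + ∫ k, φ k * w k = ∫ k, φ k * expFun k) :
    (fun k => (2 * Real.pi : ℂ)⁻¹ * fourierMeasure ν h (-k)) =ᵐ[volume]
      fun k => expFun k - w k := by
  have hcont := continuous_fourierMeasure hh
  refine ae_eq_of_forall_integral_testFunction_mul_eq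
    (Continuous.locallyIntegrable (by fun_prop))
    (locallyIntegrable_expFun.sub hw.locallyIntegrable) fun φ hφ => ?_
  simp only [mul_sub]
  rw [integral_sub (hφ.integrable_mul locallyIntegrable_expFun)
    (hφ.integrable_mul hw.locallyIntegrable), ← hpair φ hφ, integral_invFourier_mul hφ hh,
    add_sub_cancel_right]

theorem exists_L1_fourier_eq_const_mul_fourier_neg {m : ℝ → ℂ} (hm : Integrable m) (c : ℂ) :
    ∃ M : L1, ‖M‖ = ‖c‖ * ∫ x, ‖m x‖ ∧ ∀ k, fourier M k = c * fourier m (-k) := by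
  have hM : Integrable fun x => c * m (-x) := hm.comp_neg.const_mul c
  refine ⟨hM.toL1, ?_, fun k => ?_⟩
  · rw [L1.norm_of_fun_eq_integral_norm]
    simp only [norm_mul, integral_const_mul]
    rw [integral_neg_eq_self (fun x => ‖m x‖)]
  · rw [fourier_congr_ae hM.coeFn_toL1, fourier, fourier, ← integral_neg_eq_self,
      ← integral_const_mul]
    simp [mul_assoc]

theorem exists_mem_primalDomain_of_forall_integral_eq [IsFiniteMeasure ν] (hγ : 2 < γ)
    (hh : Integrable h ν) (hw : MemL2 γ w)
    (hpair : ∀ (φ : ℝ → ℂ) (hφ : IsTestFunction φ),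
      ∫ x, invFourier hφ x * h x ∂ν + ∫ k, φ k * w k = ∫ k, φ k * expFun k) :
    ∃ m ∈ primalDomain γ, ‖m‖ ≤ (2 * Real.pi)⁻¹ * ∫ x, ‖h x‖ ∂ν ∧
      normL2 γ (fun k => fourier m k - expFun k) = normL2 γ w := by
  have hae := fourierMeasure_neg_ae_eq_expFun_sub hh hw hpair
  have hdecay := hw.integrableOn_exp_mul_norm_of_const_mul_neg_ae_eq (b := 1 / 2) (by norm_num)
    (by linarith) (by simp [Real.pi_ne_zero]) hae
  obtain ⟨m₀, hm₀, hm₀_norm, hm₀_eq⟩ :=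
    exists_integrable_density_of_integrableOn_exp_mul_fourierMeasure hh (by norm_num) hdecay
  have hfourier (s : ℝ) : fourierMeasure ν h s = fourier m₀ s := by
    simp only [fourierMeasure, fourier]
    have := hm₀_eq (fun x => Complex.exp (-(Complex.I * s * x)))
      (by simpa only [mul_comm] using integrable_mul_cexp hh s)
    simpa only [mul_comm] using this
  obtain ⟨m, hm_norm, hm⟩ := exists_L1_fourier_eq_const_mul_fourier_neg hm₀ (2 * Real.pi : ℂ)⁻¹
  have hresidual : (fun k => fourier m k - expFun k) =ᵐ[volume] -w := by
    filter_upwards [hae] with k hk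
    rw [hm, ← hfourier, hk, Pi.neg_apply, sub_sub_cancel_left]
  refine ⟨m, MemL2.congr_ae (MemLp.neg hw) hresidual.symm, ?_, ?_⟩
  · rw [hm_norm, norm_inv, norm_mul, Complex.norm_real, Complex.norm_ofNat,
      Real.norm_of_nonneg Real.pi_pos.le]
    gcongr
  · rw [normL2_congr_ae hresidual, normL2, normL2, eLpNorm_neg]

end Reconstruction

theorem IsTestFunction.add {φ ψ : ℝ → ℂ} (hφ : IsTestFunction φ) (hψ : IsTestFunction ψ) :
    IsTestFunction (φ + ψ) :=
  ⟨hφ.1.add hψ.1, hφ.2.add hψ.2⟩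

theorem IsTestFunction.const_smul {φ : ℝ → ℂ} (hφ : IsTestFunction φ) (c : ℂ) :
    IsTestFunction (c • φ) :=
  ⟨hφ.1.const_smul c, hφ.2.smul_left⟩

/-- The space of test functions. -/
def testFunctions : Submodule ℂ (ℝ → ℂ) where
  carrier := {φ | IsTestFunction φ}
  add_mem' := IsTestFunction.add
  zero_mem' := ⟨contDiff_const, HasCompactSupport.zero⟩
  smul_mem' c _ hφ := hφ.const_smul c

theorem invFourier_add {φ ψ : ℝ → ℂ} (hφ : IsTestFunction φ) (hψ : IsTestFunction ψ) :
    invFourier (hφ.add hψ) = invFourier hφ + invFourier hψ := by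
  ext x
  simp only [invFourier_apply, ZeroAtInftyContinuousMap.add_apply, fourier, Pi.add_apply, add_mul]
  rw [integral_add (integrable_mul_cexp hφ.integrable _) (integrable_mul_cexp hψ.integrable _),
    mul_add]

theorem invFourier_smul {φ : ℝ → ℂ} (hφ : IsTestFunction φ) (c : ℂ) :
    invFourier (hφ.const_smul c) = c • invFourier hφ := by
  ext x
  simp only [invFourier_apply, ZeroAtInftyContinuousMap.smul_apply, fourier, Pi.smul_apply,
    smul_eq_mul, mul_assoc, integral_const_mul]
  exact mul_left_comm _ _ _

/-- The map `φ ↦ (g, ĝ)` with `ĝ = φ`, from test functions to `C₀(ℝ) × L²_{-γ}` with the maximum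
norm. -/
noncomputable def fourierPair (γ : ℝ) :
    testFunctions →ₗ[ℂ] C₀(ℝ, ℂ) × Lp ℂ 2 (expWeight (-γ)) where
  toFun φ := (invFourier φ.2, MemLp.toLp φ (φ.2.memL2 (-γ)))
  map_add' φ ψ := Prod.ext (invFourier_add φ.2 ψ.2) rfl
  map_smul' c φ := Prod.ext (invFourier_smul φ.2 c) rfl

/-- The functional `φ ↦ ∫ φ(k) e^k dk` on test functions. -/
noncomputable def integralMulExp : testFunctions →ₗ[ℂ] ℂ where
  toFun φ := ∫ k, φ.1 k * expFun k
  map_add' φ ψ := by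
    simp only [Submodule.coe_add, Pi.add_apply, add_mul]
    exact integral_add (φ.2.integrable_mul locallyIntegrable_expFun)
      (ψ.2.integrable_mul locallyIntegrable_expFun)
  map_smul' c φ := by
    simp only [Submodule.coe_smul, Pi.smul_apply, smul_eq_mul, mul_assoc, integral_const_mul,
      RingHom.id_apply]

theorem exists_strongDual_apply_fourierPair_eq {γ : ℝ} (hγ : 2 < γ) :
    ∃ F : StrongDual ℂ (C₀(ℝ, ℂ) × Lp ℂ 2 (expWeight (-γ))),
      ‖F‖ ≤ sSup (dualValues γ) ^ γ⁻¹ ∧ ∀ φ, F (fourierPair γ φ) = integralMulExp φ :=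
  exists_strongDual_apply_eq_of_norm_le (fourierPair γ) integralMulExp
    (Real.rpow_nonneg (sSup_dualValues_nonneg γ) _)
    fun φ => norm_integral_mul_expFun_le hγ φ.2

theorem exists_mem_primalDomain_norm_le {γ : ℝ} (hγ : 2 < γ)
    (F : StrongDual ℂ (C₀(ℝ, ℂ) × Lp ℂ 2 (expWeight (-γ))))
    (hF : ∀ φ, F (fourierPair γ φ) = integralMulExp φ) :
    ∃ m ∈ primalDomain γ,
      2 * Real.pi * ‖m‖ + normL2 γ (fun k => fourier m k - expFun k) ≤ ‖F‖ := by
  obtain ⟨h, hh, hh_norm, hh_eq⟩ :=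
    exists_integrable_forall_apply_eq_integral (F.comp (ContinuousLinearMap.inl ℂ _ _))
  obtain ⟨w, hw, hw_norm, hw_eq⟩ :=
    exists_memL2_forall_apply_toLp_eq_integral (F.comp (ContinuousLinearMap.inr ℂ _ _))
  obtain ⟨m, hm, hm_norm, hresidual⟩ :=
    exists_mem_primalDomain_of_forall_integral_eq hγ hh hw fun φ hφ => by
      rw [← hh_eq, ← hw_eq φ (hφ.memL2 (-γ)), ContinuousLinearMap.comp_apply,
        ContinuousLinearMap.comp_apply, ← map_add, ContinuousLinearMap.inl_apply,
        ContinuousLinearMap.inr_apply, Prod.mk_add_mk, add_zero, zero_add]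
      exact hF ⟨φ, hφ⟩
  refine ⟨m, hm, ?_⟩
  calc 2 * Real.pi * ‖m‖ + normL2 γ (fun k => fourier m k - expFun k)
      ≤ 2 * Real.pi * ((2 * Real.pi)⁻¹ * ‖F.comp (ContinuousLinearMap.inl ℂ _ _)‖) +
          ‖F.comp (ContinuousLinearMap.inr ℂ _ _)‖ := by
        rw [hresidual, hw_norm]
        gcongr
        exact hm_norm.trans (by gcongr)
    _ ≤ ‖F‖ := by
        rw [mul_inv_cancel_left₀ (by positivity)]
        exact norm_comp_inl_add_norm_comp_inr_le F

theorem primalFunctional_le_dualityConst_mul {γ C : ℝ} (hγ : 2 < γ) {m : L1}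
    (h : 2 * Real.pi * ‖m‖ + normL2 γ (fun k => fourier m k - expFun k) ≤ C) :
    primalFunctional γ m ≤ dualityConst γ * C ^ γ := by
  have : 0 < γ := by linarith
  have hγ2 : 0 < γ - 2 := by linarith
  have hresidual := normL2_nonneg γ (fun k => fourier m k - expFun k)
  calc primalFunctional γ m
      = ((2 * Real.pi) ^ (γ - 2))⁻¹ * ((2 * Real.pi * ‖m‖) ^ (γ - 2) *
          normL2 γ (fun k => fourier m k - expFun k) ^ 2) := by
        rw [primalFunctional, Real.mul_rpow (by positivity) (norm_nonneg m)]
        field_simp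
    _ ≤ ((2 * Real.pi) ^ (γ - 2))⁻¹ * (4 * (γ - 2) ^ (γ - 2) / γ ^ γ * C ^ γ) := by
        refine mul_le_mul_of_nonneg_left ?_ (by positivity)
        refine (rpow_sub_two_mul_sq_le hγ (by positivity) hresidual).trans ?_
        gcongr
    _ = dualityConst γ * C ^ γ := by
        rw [dualityConst]
        field_simp

theorem exists_primalFunctional_le {γ : ℝ} (hγ : 2 < γ) :
    ∃ m ∈ primalDomain γ, primalFunctional γ m ≤ dualityConst γ * sSup (dualValues γ) := by
  obtain ⟨F, hF_norm, hF⟩ := exists_strongDual_apply_fourierPair_eq hγ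
  obtain ⟨m, hm, hm_norm⟩ := exists_mem_primalDomain_norm_le hγ F hF
  refine ⟨m, hm, (primalFunctional_le_dualityConst_mul hγ (hm_norm.trans hF_norm)).trans_eq ?_⟩
  rw [Real.rpow_inv_rpow (sSup_dualValues_nonneg γ) (by linarith)]

theorem exists_isPrimalMinimizer {γ : ℝ} (hγ : 2 < γ) :
    ∃ m, IsPrimalMinimizer γ m ∧
      primalFunctional γ m = dualityConst γ * sSup (dualValues γ) := by
  obtain ⟨m, hm, hle⟩ := exists_primalFunctional_le hγ
  have hinf : dualityConst γ * sSup (dualValues γ) ≤ primalInf γ := by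
    refine le_csInf ⟨_, m, hm, rfl⟩ ?_
    rintro _ ⟨m', hm', rfl⟩
    exact dualityConst_mul_sSup_le hγ hm'
  exact ⟨m, ⟨hm, (hle.trans hinf).antisymm (primalInf_le hm)⟩,
    hle.antisymm (dualityConst_mul_sSup_le hγ hm)⟩

end PrimalOptimizer

theorem theoremC1 (γ : ℝ) (hγ : 2 < γ) :
    -- the infimum is a minimum
    IsLeast (primalFunctional γ '' primalDomain γ) (primalInf γ) ∧
    -- the minimizers form exactly one orbit of the scaling transformation
    (∃ m : L1, IsPrimalMinimizer γ m) ∧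
    (∀ m : L1, IsPrimalMinimizer γ m → ∀ m' : L1,
      (IsPrimalMinimizer γ m' ↔
        ∃ α : ℝ, 0 < α ∧
          m' =ᵐ[volume] fun x : ℝ => m x * (α : ℂ) ^ (-(Complex.I * (x : ℂ)) - 1))) ∧
    -- the pairing of the exponential with the Fourier transform of `g` is well defined
    (∀ (g : C₀(ℝ, ℂ)) (u : ℝ → ℂ), IsDualAdmissible γ g u → ∃! z : ℂ, HasExpPairing u z) ∧
    -- the dual formula over `C₀(ℝ)`, with a finite supremum
    (dualValues γ).Nonempty ∧ BddAbove (dualValues γ) ∧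
    primalInf γ =
      4 * (γ - 2) ^ (γ - 2) / ((2 * Real.pi) ^ (γ - 2) * γ ^ γ) * sSup (dualValues γ) := by
  obtain ⟨m₀, hm₀, hdual⟩ := exists_isPrimalMinimizer hγ
  refine ⟨⟨⟨m₀, hm₀.1, hm₀.2⟩, ?_⟩, ⟨m₀, hm₀⟩, fun m hm m' => isPrimalMinimizer_iff hγ hm m', ?_,
    dualValues_nonempty hγ, bddAbove_dualValues hγ, hm₀.2.symm.trans hdual⟩
  · rintro _ ⟨m', hm', rfl⟩
    exact primalInf_le hm'
  · intro g u hu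
    exact ⟨_, hasExpPairing_expPairing hu hm₀.1,
      fun z hz => hz.unique (hasExpPairing_expPairing hu hm₀.1)⟩
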